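/- Let $a>0$ and let $D_a$ be a finite simply connected discrete domain in $a\mathbb{Z}^2$, i.e. the subgraph of $a\mathbb{Z}^2$ formed by the boundaries of a finite set of square faces whose union is a simply connected subset of the plane. Let $V$, $E$ be its vertex and edge sets and $F$ its set of square faces. \emph{Loop soup spin field.} Give every rooted nearest-neighbour loop $\gamma$ in $D_a$ with $t_\gamma\ge 1$ steps the mass $\tilde\mu(\gamma)=4^{-t_\gamma}/t_\gamma$. The random walk loop soup with intensity $\lambda$ is the Poisson point process of loops with intensity measure $\lambda\tilde\mu$. For $z\in F$ let $\tilde N(z)$ be the sum over the loops of the soup of their winding numbers around $z$, and let $\sigma(z)=e^{i\pi\tilde N(z)}\in\{\pm1\}$. \emph{DGFF.} The discrete Gaussian free field $\varphi$ on $D_a$ with zero boundary conditions has density on $\mathbb{R}^V$ proportional to $\exp\big(-\tfrac12\sum_{x\sim y}(\varphi_x-\varphi_y)^2\big)$, the sum being over the edges of $E$ and over the edges leading from $D_a$ to its boundary, where $\varphi=0$. (Every edge of $a\mathbb{Z}^2$ that contains $x\in V$ and does not belong to $E$ counts as an edge from $x$ to the boundary.) \emph{Ising models.} The Ising model on a graph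 with coupling constants $J$ has probabilities proportional to $\exp\big(-\tfrac12\sum_{x\sim y}J_{\{x,y\}}(s_x-s_y)^2\big)$. On $D_a$ with free boundary conditions the sum is over $E$. On the dual domain $D_a^*$ with $+1$ boundary conditions, the spins sit on $F$, the spin of the unbounded face is fixed to be $+1$, and the sum is over the dual edges $e^*$ crossing the edges $e\in E$. \textbf{Theorem.} The loop soup with intensity $\lambda=\tfrac12$ is almost surely finite. Sample the amplitude $|\varphi|$ of the DGFF on $D_a$ with zero boundary conditions, and then, given $|\varphi|$, sample the Ising model on $D_a^*$ with $+1$ boundary conditions and coupling constants $$J_{\{x,y\}^*}=-\tfrac12\log\tanh|\varphi_x\varphi_y| ,\qquad \{x,y\}\in E .$$ The resulting assignment of $\pm1$'s to the faces of $D_a$ has the law of the spin field $\sigma$ with $\lambda=\tfrac12$. Moreover, given $|\varphi|$, the law of $\operatorname{sgn}(\varphi)$ is the Ising model on $D_a$ with free boundary conditions and coupling constants $J_{\{x,y\}}=|\varphi_x\varphi_y|$, so that the two Ising models are related by the Kramers--Wannier relation $J_{e^*}=-\tfrac12\log\tanh J_e$. -/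

import Mathlib

open MeasureTheory ProbabilityTheory
open scoped NNReal ENNReal

noncomputable section

namespace LoopSoup

/-! ### The square lattice with mesh `a`, its edges and its faces

The lattice site `x : ℤ × ℤ` is the point `a (x.1 + i x.2)` of the plane.  A face is labelled by
its lower left corner.  An edge is labelled by its left (or lower) end point and its direction. -/

abbrev Site := ℤ × ℤ

abbrev Face := ℤ × ℤ

/-- An edge of the square lattice: `(x, true)` joins `x` to `x + (1, 0)`, and
`(x, false)` joins `x` to `x + (0, 1)`. -/
abbrev Edge := (ℤ × ℤ) × Bool

/-- The point of the plane occupied by a site. -/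
def point (a : ℝ) (x : Site) : ℂ := ⟨a * x.1, a * x.2⟩

/-- The centre of a face. -/
def centre (a : ℝ) (f : Face) : ℂ := ⟨a * (f.1 + 1 / 2), a * (f.2 + 1 / 2)⟩

/-- The closed square of the plane occupied by a face. -/
def square (a : ℝ) (f : Face) : Set ℂ :=
  {z | a * f.1 ≤ z.re ∧ z.re ≤ a * (f.1 + 1) ∧ a * f.2 ≤ z.im ∧ z.im ≤ a * (f.2 + 1)}

/-- The two end points of an edge. -/
def ends (e : Edge) : Site × Site :=
  if e.2 then (e.1, (e.1.1 + 1, e.1.2)) else (e.1, (e.1.1, e.1.2 + 1))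

/-- The two faces on either side of an edge, i.e. the end points of the dual edge. -/
def dualEnds (e : Edge) : Face × Face :=
  if e.2 then (e.1, (e.1.1, e.1.2 - 1)) else (e.1, (e.1.1 - 1, e.1.2))

/-- The four corners of a face. -/
def corners (f : Face) : Finset Site :=
  {f, (f.1 + 1, f.2), (f.1, f.2 + 1), (f.1 + 1, f.2 + 1)}

/-- The four sides of a face. -/
def sides (f : Face) : Finset Edge :=
  {(f, true), (f, false), ((f.1, f.2 + 1), true), ((f.1 + 1, f.2), false)}

/-- The four lattice edges that contain a site. -/
def star (x : Site) : Finset Edge :=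
  {(x, true), (x, false), ((x.1 - 1, x.2), true), ((x.1, x.2 - 1), false)}

/-- A (finite) simply connected discrete domain in the square lattice of mesh `a`: a finite union
of faces that is a simply connected (in particular non-empty and connected) subset of the
plane. -/
structure DiscreteDomain (a : ℝ) where
  faces : Finset Face
  simplyConnected : SimplyConnectedSpace (⋃ f ∈ faces, square a f : Set ℂ)

variable {a : ℝ}

/-- The vertices of the domain. -/
def DiscreteDomain.sites (D : DiscreteDomain a) : Finset Site := D.faces.biUnion corners

/-- The edges of the domain. -/
def DiscreteDomain.edges (D : DiscreteDomain a) : Finset Edge := D.faces.biUnion sides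

/-- The domain as a graph: the union of the boundaries of its faces. -/
def DiscreteDomain.graph (D : DiscreteDomain a) : SimpleGraph D.sites where
  Adj x y := ∃ e ∈ D.edges, ends e = (x.1, y.1) ∨ ends e = (y.1, x.1)
  symm := ⟨fun _ _ ⟨e, he, h⟩ => ⟨e, he, h.symm⟩⟩
  loopless := ⟨fun x ⟨e, _, h⟩ => by
    obtain ⟨⟨u, v⟩, b⟩ := e
    obtain ⟨⟨p, q⟩, hx⟩ := x
    cases b <;> simp [ends] at h <;> omega⟩

/-! ### The random walk loop soup and its winding spin field -/

/-- A rooted nearest neighbour loop in the domain: a closed walk with at least one step. -/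
abbrev Loop (D : DiscreteDomain a) := Σ x : D.sites, {p : D.graph.Walk x x // 0 < p.length}

/-- The mass `4 ^ (-t) / t` of a loop with `t` steps. -/
def loopMass {D : DiscreteDomain a} (γ : Loop D) : ℝ≥0 :=
  (γ.2.1.length : ℝ≥0)⁻¹ * (4⁻¹ : ℝ≥0) ^ γ.2.1.length

/-- The law of the random walk loop soup with intensity `l`, the Poisson point process on the
countable set of loops with intensity measure `l` times the loop measure.  A realization is given
by the multiplicity of every loop; the multiplicities are independent Poisson variables. -/
def loopSoup (D : DiscreteDomain a) (l : ℝ≥0) : Measure (Loop D → ℕ) :=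
  Measure.infinitePi fun γ => poissonMeasure (l * loopMass γ)

/-- The total variation of the argument, seen from `c`, along the linear interpolation of a walk:
the sum of the oriented angles under which its steps are seen from `c`. -/
def totalAngle {D : DiscreteDomain a} {x y : D.sites} (p : D.graph.Walk x y) (c : ℂ) : ℝ :=
  (p.darts.map fun d =>
    Complex.arg ((point a d.snd.1 - c) / (point a d.fst.1 - c))).sum

/-- The winding number of a closed walk around `c`: the total angle divided by `2π`.  That number
is already an integer, see `windingNumber_mul_two_pi`. -/
def windingNumber {D : DiscreteDomain a} {x : D.sites} (p : D.graph.Walk x x) (c : ℂ) : ℤ :=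
  round (totalAngle p c / (2 * Real.pi))

theorem exp_totalAngle {D : DiscreteDomain a} {x y : D.sites} (p : D.graph.Walk x y) (c : ℂ)
    (hc : ∀ z : Site, point a z ≠ c) :
    Complex.exp (totalAngle p c * Complex.I) * ((point a x.1 - c) / ‖point a x.1 - c‖) =
      (point a y.1 - c) / ‖point a y.1 - c‖ := by
  induction p with
  | nil => simp [totalAngle]
  | @cons u v w h p ih =>
    rw [← ih]
    have hu : point a u.1 - c ≠ 0 := sub_ne_zero.2 (hc _)
    have hv : point a v.1 - c ≠ 0 := sub_ne_zero.2 (hc _)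
    have hstep : totalAngle (SimpleGraph.Walk.cons h p) c =
        Complex.arg ((point a v.1 - c) / (point a u.1 - c)) + totalAngle p c := by
      simp [totalAngle]
    have hexp : Complex.exp (Complex.arg ((point a v.1 - c) / (point a u.1 - c)) * Complex.I) *
        ((point a u.1 - c) / ‖point a u.1 - c‖) = (point a v.1 - c) / ‖point a v.1 - c‖ := by
      have h1 := Complex.norm_mul_exp_arg_mul_I ((point a v.1 - c) / (point a u.1 - c))
      rw [norm_div, Complex.ofReal_div] at h1
      have hu' : (‖point a u.1 - c‖ : ℂ) ≠ 0 := by simpa using hu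
      have hv' : (‖point a v.1 - c‖ : ℂ) ≠ 0 := by simpa using hv
      field_simp at h1 ⊢
      linear_combination h1
    rw [hstep, Complex.ofReal_add, add_mul, add_comm, Complex.exp_add, mul_assoc, hexp]

theorem windingNumber_mul_two_pi {D : DiscreteDomain a} {x : D.sites} (p : D.graph.Walk x x)
    (c : ℂ) (hc : ∀ z : Site, point a z ≠ c) :
    (windingNumber p c : ℝ) * (2 * Real.pi) = totalAngle p c := by
  have hx : point a x.1 - c ≠ 0 := sub_ne_zero.2 (hc _)
  have hx' : (‖point a x.1 - c‖ : ℂ) ≠ 0 := by simpa using hx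
  have h := mul_eq_right₀ (div_ne_zero hx hx') |>.1 (exp_totalAngle p c hc)
  obtain ⟨n, hn⟩ := Complex.exp_eq_one_iff.1 h
  have hn' : totalAngle p c = n * (2 * Real.pi) := by
    have := congrArg Complex.im hn
    simpa using this
  have hpi : (2 * Real.pi) ≠ 0 := by positivity
  rw [windingNumber, hn', mul_div_cancel_right₀ _ hpi, round_intCast]

/-- The total winding number around the centre of a face of the loops in a realization of the loop
soup (almost every realization has only finitely many loops). -/
def totalWinding {D : DiscreteDomain a} (L : Loop D → ℕ) (z : Face) : ℤ :=
  ∑ᶠ γ : Loop D, (L γ : ℤ) * windingNumber γ.2.1 (centre a z)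

/-- The spin `exp (iπ N) = (-1) ^ N` at a face, where `N` is the total winding number. -/
def spinField (D : DiscreteDomain a) (L : Loop D → ℕ) : D.faces → ℤˣ :=
  fun z => (totalWinding L z.1).negOnePow

/-! ### The discrete Gaussian free field with zero boundary conditions -/

/-- Extension of a function on a finite set by a constant. -/
def extend {α β : Type*} [DecidableEq α] (S : Finset α) (c : β) (f : S → β) : α → β :=
  fun x => if h : x ∈ S then f ⟨x, h⟩ else c

/-- The Dirichlet energy `1/2 ∑ (φ x - φ y) ^ 2` over all lattice edges `{x, y}` that touch the
domain, where `φ = 0` on the boundary.  An edge outside the domain that contains a vertex `x` of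
the domain is an edge from `x` to the boundary, and contributes `(φ x - 0) ^ 2`.
(When both end points of such an edge belong to the domain it leads from each of them to the
boundary: the random walk in the domain is killed if it attempts to cross it.) -/
def DiscreteDomain.energy (D : DiscreteDomain a) (φ : D.sites → ℝ) : ℝ :=
  1 / 2 * ∑ e ∈ D.sites.biUnion star,
    if e ∈ D.edges then
      (extend D.sites 0 φ (ends e).1 - extend D.sites 0 φ (ends e).2) ^ 2
    else
      (extend D.sites 0 φ (ends e).1 - 0) ^ 2 + (extend D.sites 0 φ (ends e).2 - 0) ^ 2

/-- The law of the discrete Gaussian free field with zero boundary conditions, with density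
`exp (-energy) / Z` with respect to Lebesgue measure. -/
def DiscreteDomain.dgff (D : DiscreteDomain a) : Measure (D.sites → ℝ) :=
  (∫⁻ φ, ENNReal.ofReal (Real.exp (-D.energy φ)))⁻¹ •
    (volume.withDensity fun φ => ENNReal.ofReal (Real.exp (-D.energy φ)))

/-- The amplitude `|φ|` of a field. -/
def amplitude {S : Finset Site} (φ : S → ℝ) : S → ℝ := fun x => |φ x|

/-- The sign of a field (with the sign of `0`, which has probability zero, taken to be `1`). -/
def fieldSign {S : Finset Site} (φ : S → ℝ) : S → ℤˣ := fun x => if 0 ≤ φ x then 1 else -1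

/-! ### Ising models -/

/-- The energy `1/2 ∑ J e (s x - s y) ^ 2` of a spin configuration on a finite set `S` of
lattice sites or faces, over a finite set `E` of edges.  The end points of edges are given by `i`,
and the spins outside `S` are `+1`. -/
def isingEnergy (S : Finset (ℤ × ℤ)) (E : Finset Edge) (i : Edge → (ℤ × ℤ) × (ℤ × ℤ))
    (J : Edge → ℝ) (s : S → ℤˣ) : ℝ :=
  1 / 2 * ∑ e ∈ E,
    J e * (((extend S (1 : ℤˣ) s (i e).1 : ℤˣ) : ℤ) - ((extend S (1 : ℤˣ) s (i e).2 : ℤˣ) : ℤ) : ℝ) ^ 2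

/-- The Ising measure, with density `exp (-isingEnergy) / Z'` with respect to counting measure. -/
def isingMeasure (S : Finset (ℤ × ℤ)) (E : Finset Edge) (i : Edge → (ℤ × ℤ) × (ℤ × ℤ))
    (J : Edge → ℝ) : Measure (S → ℤˣ) :=
  Measure.count.withDensity fun s => ENNReal.ofReal
    (Real.exp (-isingEnergy S E i J s) / ∑ s' : S → ℤˣ, Real.exp (-isingEnergy S E i J s'))

/-- The Ising model on the domain with free boundary conditions. All edges of the domain have both
end points in the domain, so no spin outside the domain enters. -/
def DiscreteDomain.isingFree (D : DiscreteDomain a) (J : Edge → ℝ) : Measure (D.sites → ℤˣ) :=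
  isingMeasure D.sites D.edges ends J

/-- The Ising model on the dual domain with `+1` boundary conditions.  The spins live on the faces
of the domain, `J e` is the coupling constant of the dual edge crossing `e`, and the unbounded
face has spin `+1`. -/
def DiscreteDomain.isingDualPlus (D : DiscreteDomain a) (J : Edge → ℝ) :
    Measure (D.faces → ℤˣ) :=
  isingMeasure D.faces D.edges dualEnds J

/-- The coupling constants `|r x * r y|` given by an amplitude `r`. -/
def DiscreteDomain.coupling (D : DiscreteDomain a) (r : D.sites → ℝ) (e : Edge) : ℝ :=
  |extend D.sites 0 r (ends e).1 * extend D.sites 0 r (ends e).2|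

/-- The dual coupling constants `-1/2 log (tanh (J e))` of Kramers and Wannier. -/
def dualCoupling (J : Edge → ℝ) (e : Edge) : ℝ := -(1 / 2) * Real.log (Real.tanh (J e))

end LoopSoup

end

/-!
The proof compares the correlations `E[∏ z ∈ B, σ z]`, for all sets `B` of faces, under the two laws
of spins on the faces; these determine the law (`ext_of_sum_prod_spins`).

*Loop soup.*  Put the sign `-1` on the edges crossing the horizontal half line from the centre of
`z` to the left (`cutSign`), and let `gauge B` be the product of these signs over `z ∈ B`.  The
parity of the winding number of a loop around `z` is that of its number of crossings of this cut
(`negOnePow_windingNumber`), so the product of the spins in `B` is the product over the loops of the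
soup of their holonomies.  For a Poisson process this has expectation
`exp (1 / 2 * ∑ γ, μ γ * (holonomy γ - 1))` (`integral_finprod_pow_infinitePi`), and
`∑ γ, μ γ * holonomy γ = ∑ t, tr (P ^ t) / t = -log det (1 - P)`, with `P` the transition matrix of
the killed walk twisted by `gauge B` (`hasSum_loopMass_mul_loopSign`).  The series converges since
`1 - P` and `1 + P` are positive definite, which also shows that the soup is finite.  So the
correlation is `(det (1 - P₁) / det (1 - P)) ^ (1 / 2)`, a ratio of Gaussian partition functions.

*Gaussian free field.*  Lebesgue measure is invariant under sign flips of coordinates, so that a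
field is obtained from its amplitude by resampling the signs (`lintegral_signMul`).  Given the
amplitude, the signs form a free Ising model, possibly with couplings twisted by a gauge
(`weight_signMul`).  This is the last claim, and it expresses the ratio of Gaussian partition
functions as the expectation of the ratio of twisted and untwisted Ising partition functions
(`lintegral_dgff_twistedSum_div`).

*Duality.*  The high temperature expansion of the Ising model on the sites is a sum over even
subgraphs, and these are the contours of the spin configurations on the faces
(`contour_cutProd`, `contour_injective`).  The product of `gauge B` over a contour is the product of
the spins in `B` (`prod_contour_gauge`), so the ratio of Ising partition functions is the
correlation of the dual model (`sum_isingProb_dual`).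

Simple connectedness enters once: an even subgraph must not surround a face outside the domain.
On a simply connected set that misses the centre `c` of such a face, `w - c` has a logarithm that is
continuous along paths, so that the cut sign of the face is a coboundary on the domain
(`exists_cutSign_eq_coboundary`), and its product over an even subgraph is one.
-/

noncomputable section

namespace LoopSoup

variable {a : ℝ}

/-! ### Traces, determinants and Gaussian integrals of symmetric matrices -/

section Matrices

open Matrix

variable {n : Type*} [Fintype n]

theorem trace_pow_eq_sum_eigenvalues [DecidableEq n] {A : Matrix n n ℝ} (hA : A.IsHermitian)
    (k : ℕ) :
    (A ^ k).trace = ∑ i, hA.eigenvalues i ^ k := by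
  conv_lhs => rw [hA.spectral_theorem]
  rw [← map_pow, Unitary.conjStarAlgAut_apply, trace_mul_cycle, Unitary.coe_star_mul_self, one_mul,
    diagonal_pow, trace_diagonal]
  rfl

theorem det_one_sub_eq_prod_eigenvalues [DecidableEq n] {A : Matrix n n ℝ} (hA : A.IsHermitian) :
    (1 - A).det = ∏ i, (1 - hA.eigenvalues i) := by
  have h := congrArg (Polynomial.eval 1) hA.charpoly_eq
  rw [eval_charpoly, Polynomial.eval_prod] at h
  simpa using h

theorem abs_eigenvalues_lt_one [DecidableEq n] {A : Matrix n n ℝ} (hA : A.IsHermitian)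
    (h₁ : (1 - A).PosDef) (h₂ : (1 + A).PosDef) (i : n) : |hA.eigenvalues i| < 1 := by
  set v : n → ℝ := ⇑(hA.eigenvectorBasis i) with hv
  have hv0 : v ≠ 0 := by
    intro h
    have h1 := hA.eigenvectorBasis.orthonormal.ne_zero i
    apply h1
    ext j
    simpa using congrFun h j
  have hAv : A *ᵥ v = hA.eigenvalues i • v := hA.mulVec_eigenvectorBasis i
  have hpos : 0 < Star.star v ⬝ᵥ v := dotProduct_star_self_pos_iff.2 hv0
  have e₁ := h₁.dotProduct_mulVec_pos hv0
  have e₂ := h₂.dotProduct_mulVec_pos hv0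
  rw [sub_mulVec, one_mulVec, hAv, dotProduct_sub, dotProduct_smul, smul_eq_mul] at e₁
  rw [add_mulVec, one_mulVec, hAv, dotProduct_add, dotProduct_smul, smul_eq_mul] at e₂
  rw [abs_lt]
  constructor <;> nlinarith

/-- The power series of `-log det (1 - A)` for a symmetric contraction `A`. -/
theorem hasSum_trace_pow_div [DecidableEq n] {A : Matrix n n ℝ} (hA : A.IsHermitian)
    (h₁ : (1 - A).PosDef) (h₂ : (1 + A).PosDef) :
    HasSum (fun k : ℕ => (A ^ (k + 1)).trace / (k + 1)) (-Real.log (1 - A).det) := by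
  have hlt := abs_eigenvalues_lt_one hA h₁ h₂
  have h := hasSum_sum (s := Finset.univ) fun i _ => Real.hasSum_pow_div_log_of_abs_lt_one (hlt i)
  rw [det_one_sub_eq_prod_eigenvalues hA, Real.log_prod
    (fun i _ => (sub_pos.2 (abs_lt.1 (hlt i)).2).ne'), ← Finset.sum_neg_distrib]
  refine h.congr_fun fun k => ?_
  rw [trace_pow_eq_sum_eigenvalues hA, Finset.sum_div]

/-- A square root factorisation, which reduces Gaussian integrals to the standard one by a linear
change of variables. -/
theorem exists_transpose_mul_self_eq [DecidableEq n] {M : Matrix n n ℝ} (hM : M.PosDef) :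
    ∃ B : Matrix n n ℝ, Bᵀ * B = M := by
  set U := hM.1.eigenvectorUnitary
  refine ⟨diagonal (fun i => √(hM.1.eigenvalues i)) * Star.star (U : Matrix n n ℝ), ?_⟩
  conv_rhs => rw [hM.1.spectral_theorem, Unitary.conjStarAlgAut_apply]
  rw [transpose_mul, diagonal_transpose, mul_assoc, ← mul_assoc (diagonal _) (diagonal _),
    diagonal_mul_diagonal, star_eq_conjTranspose, conjTranspose_eq_transpose_of_trivial,
    transpose_transpose, ← mul_assoc]
  congr 3
  ext i
  simp [Real.mul_self_sqrt (hM.eigenvalues_pos i).le]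

/-- The Gaussian integral of a quadratic form is inversely proportional to the square root of its
determinant. -/
theorem lintegral_exp_neg_quadratic [DecidableEq n] {M : Matrix n n ℝ} (hM : M.PosDef) :
    ∫⁻ φ : n → ℝ, ENNReal.ofReal (Real.exp (-(1 / 2 * (φ ⬝ᵥ M *ᵥ φ)))) =
      ENNReal.ofReal (√M.det)⁻¹ *
        ∫⁻ φ : n → ℝ, ENNReal.ofReal (Real.exp (-(1 / 2 * (φ ⬝ᵥ φ)))) := by
  obtain ⟨B, hB⟩ := exists_transpose_mul_self_eq hM
  have hdet : M.det = |B.det| ^ 2 := by rw [← hB, det_mul, det_transpose, sq_abs, sq]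
  have hB0 : B.det ≠ 0 := by
    intro h
    have := hM.det_pos
    simp [hdet, h] at this
  have hmeas : Measurable fun φ : n → ℝ => ENNReal.ofReal (Real.exp (-(1 / 2 * (φ ⬝ᵥ φ)))) := by
    unfold dotProduct
    fun_prop
  have hlin : Measurable (toLin' B) := (LinearMap.continuous_of_finiteDimensional _).measurable
  have h := lintegral_map (μ := volume) hmeas hlin
  rw [Real.map_matrix_volume_pi_eq_smul_volume_pi hB0, lintegral_smul_measure] at h
  rw [hdet, Real.sqrt_sq (abs_nonneg _), ← abs_inv, ← smul_eq_mul, h]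
  refine lintegral_congr fun φ => ?_
  rw [toLin'_apply, ← hB, ← mulVec_mulVec, dotProduct_mulVec, vecMul_transpose]

theorem lintegral_exp_neg_sq_ne_zero :
    ∫⁻ φ : n → ℝ, ENNReal.ofReal (Real.exp (-(1 / 2 * (φ ⬝ᵥ φ)))) ≠ 0 := by
  have hmeas : Measurable fun φ : n → ℝ => ENNReal.ofReal (Real.exp (-(1 / 2 * (φ ⬝ᵥ φ)))) := by
    unfold dotProduct
    fun_prop
  rw [Ne, lintegral_eq_zero_iff hmeas]
  intro h
  obtain ⟨φ, hφ⟩ := h.exists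
  simp only [Pi.zero_apply, ENNReal.ofReal_eq_zero] at hφ
  exact absurd hφ (not_le.2 (Real.exp_pos _))

theorem lintegral_exp_neg_sq_ne_top :
    ∫⁻ φ : n → ℝ, ENNReal.ofReal (Real.exp (-(1 / 2 * (φ ⬝ᵥ φ)))) ≠ ∞ := by
  have hint : Integrable (fun φ : n → ℝ => ∏ i, Real.exp (-(1 / 2) * φ i ^ 2)) :=
    Integrable.fintype_prod (f := fun _ x => Real.exp (-(1 / 2) * x ^ 2))
      fun _ => integrable_exp_neg_mul_sq (by norm_num)
  have h := hint.lintegral_lt_top.ne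
  convert h using 5 with φ
  rw [← Real.exp_sum, ← Finset.mul_sum, neg_mul, dotProduct]
  simp [sq]

end Matrices

/-! ### Poisson point processes on a countable set -/

section Poisson

open Filter Topology

/-- The probability generating function of the Poisson law. -/
theorem integral_pow_poissonMeasure (r : ℝ≥0) (c : ℝ) :
    ∫ n : ℕ, c ^ n ∂poissonMeasure r = Real.exp (r * (c - 1)) := by
  rw [integral_poissonMeasure]
  have h := (NormedSpace.expSeries_div_hasSum_exp (r * c : ℝ)).mul_left (Real.exp (-r))
  rw [← Real.exp_eq_exp_ℝ, ← Real.exp_add] at h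
  rw [show (r : ℝ) * (c - 1) = -r + r * c by ring, ← h.tsum_eq]
  refine tsum_congr fun n => ?_
  rw [smul_eq_mul, mul_pow]
  ring

variable {ι : Type*} {r : ι → ℝ≥0}

theorem poissonMeasure_ne_zero_le (s : ℝ≥0) : poissonMeasure s {n | n ≠ 0} ≤ s := by
  have h : {n : ℕ | n ≠ 0} = {0}ᶜ := rfl
  rw [h, prob_compl_eq_one_sub (measurableSet_singleton 0), poissonMeasure_singleton]
  simp only [pow_zero, mul_one, Nat.factorial_zero, Nat.cast_one, div_one]
  rw [← ENNReal.ofReal_one, ← ENNReal.ofReal_sub _ (Real.exp_pos _).le,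
    ENNReal.ofReal_le_iff_le_toReal (by simp)]
  have := Real.add_one_le_exp (-s : ℝ)
  simp only [ENNReal.coe_toReal]
  linarith

/-- By the Borel-Cantelli lemma, a Poisson point process of finite total intensity is almost surely
finite. -/
theorem ae_finite_infinitePi_poissonMeasure [Countable ι] (hr : Summable r) :
    ∀ᵐ L ∂(Measure.infinitePi fun i => poissonMeasure (r i)), {i | L i ≠ 0}.Finite := by
  refine ae_finite_setOfPred_mem (s := fun i => {L : ι → ℕ | L i ≠ 0}) ?_
  have h : ∀ i, (Measure.infinitePi fun i => poissonMeasure (r i)) {L : ι → ℕ | L i ≠ 0} ≤ r i := by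
    intro i
    refine le_trans (le_of_eq ?_) (poissonMeasure_ne_zero_le (r i))
    exact (measurePreserving_eval_infinitePi (fun i => poissonMeasure (r i)) i).measure_preimage
      (s := {n : ℕ | n ≠ 0}) MeasurableSet.of_discrete.nullMeasurableSet
  exact ne_top_of_le_ne_top (ENNReal.tsum_coe_ne_top_iff_summable.2 hr) (ENNReal.tsum_le_tsum h)

theorem integral_prod_pow_infinitePi (c : ι → ℝ) (S : Finset ι) :
    ∫ L, ∏ i ∈ S, c i ^ L i ∂(Measure.infinitePi fun i => poissonMeasure (r i)) =
      Real.exp (∑ i ∈ S, r i * (c i - 1)) := by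
  have h := integral_restrict_infinitePi (μ := fun i => poissonMeasure (r i)) (s := S)
    (f := fun L : S → ℕ => ∏ i : S, c i ^ L i) (by
      refine Measurable.aestronglyMeasurable ?_
      exact Finset.measurable_prod _ fun i _ =>
        (Measurable.of_discrete (f := fun n : ℕ => c i ^ n)).comp (measurable_pi_apply i))
  rw [integral_fintype_prod_eq_prod (fun i : S => fun n : ℕ => c i ^ n)] at h
  simp only [integral_pow_poissonMeasure, Finset.restrict] at h
  rw [← Real.exp_sum] at h
  rw [← Finset.sum_coe_sort S, ← h]
  refine integral_congr_ae (ae_of_all _ fun L => ?_)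
  exact (Finset.prod_coe_sort S fun i => c i ^ L i).symm

theorem tendsto_prod_pow_of_finite (c : ι → ℝ) {L : ι → ℕ} (hL : {i | L i ≠ 0}.Finite) :
    Tendsto (fun S : Finset ι => ∏ i ∈ S, c i ^ L i) atTop (𝓝 (∏ᶠ i, c i ^ L i)) := by
  have h : (Function.mulSupport fun i => c i ^ L i) ⊆ hL.toFinset := by
    intro i hi
    simp only [Function.mem_mulSupport] at hi
    simp only [Set.Finite.coe_toFinset, Set.mem_ofPred_eq]
    rintro h0
    simp [h0] at hi
  refine tendsto_const_nhds.congr' ?_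
  filter_upwards [eventually_ge_atTop hL.toFinset] with S hS
  exact finprod_eq_prod_of_mulSupport_subset _ (h.trans (by exact_mod_cast hS))

/-- The Laplace functional (Campbell's formula) of a Poisson point process of finite total
intensity, for multiplicative functionals of modulus one. -/
theorem integral_finprod_pow_infinitePi [Countable ι] (hr : Summable r) (c : ι → ℝ)
    (hc : ∀ i, |c i| = 1) :
    ∫ L, ∏ᶠ i, c i ^ L i ∂(Measure.infinitePi fun i => poissonMeasure (r i)) =
      Real.exp (∑' i, r i * (c i - 1)) := by
  have hr' : Summable fun i => (r i : ℝ) := NNReal.summable_coe.2 hr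
  have hsum : Summable fun i => (r i : ℝ) * (c i - 1) := by
    refine Summable.of_norm_bounded (hr'.mul_right 2) fun i => ?_
    rw [norm_mul, Real.norm_of_nonneg (r i).coe_nonneg]
    refine mul_le_mul_of_nonneg_left ?_ (r i).2
    have := abs_sub (c i) 1
    rw [hc i, abs_one] at this
    rw [Real.norm_eq_abs]
    linarith
  have h₁ := (Real.continuous_exp.tendsto _).comp hsum.hasSum
  refine tendsto_nhds_unique ?_ h₁
  have h₂ := tendsto_integral_filter_of_dominated_convergence
    (μ := Measure.infinitePi fun i => poissonMeasure (r i)) (l := (atTop : Filter (Finset ι)))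
    (F := fun S L => ∏ i ∈ S, c i ^ L i) (f := fun L => ∏ᶠ i, c i ^ L i) (fun _ => 1)
    (Eventually.of_forall fun S => ?_) (Eventually.of_forall fun S => ae_of_all _ fun L => ?_)
    (integrable_const _) ?_
  · refine h₂.congr fun S => ?_
    exact integral_prod_pow_infinitePi c S
  · refine Measurable.aestronglyMeasurable ?_
    exact Finset.measurable_prod _ fun i _ =>
      (Measurable.of_discrete (f := fun n : ℕ => c i ^ n)).comp (measurable_pi_apply i)
  · simp [hc]
  · filter_upwards [ae_finite_infinitePi_poissonMeasure hr] with L hL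
    exact tendsto_prod_pow_of_finite c hL

end Poisson

/-! ### Even subgraphs and spins on the faces -/

/-- The sign attached to an edge by the cut that runs from the centre of the face `z` horizontally
to the left: it is `-1` if the edge crosses the cut. -/
def cutSign (z : Face) (e : Edge) : ℤˣ :=
  if e.2 = false ∧ e.1.2 = z.2 ∧ e.1.1 ≤ z.1 then -1 else 1

/-- A finite set of edges is an even subgraph if every `±1`-valued coboundary has product one over
it.  (Testing this with functions that are `-1` at one vertex only shows that all degrees are
even.) -/
def IsEvenSubgraph (H : Finset Edge) : Prop :=
  ∀ s : Site → ℤˣ, ∏ e ∈ H, s (ends e).1 * s (ends e).2 = 1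

/-- The parity of the number of edges of `H` that cross the cut of a face. -/
def cutProd (H : Finset Edge) (z : Face) : ℤˣ := ∏ e ∈ H, cutSign z e

theorem prod_ite_eq_neg_one (H : Finset Edge) (e : Edge) :
    ∏ e' ∈ H, (if e' = e then (-1 : ℤˣ) else 1) = if e ∈ H then -1 else 1 := by
  rw [Finset.prod_ite_eq']

/-- The spins `cutProd H` of an even subgraph `H` change exactly across the edges of `H`.  For a
vertical edge this is clear; for a horizontal edge the two cuts bound a half infinite strip, whose
other edges form the coboundary of the row of sites inside. -/
theorem cutProd_mul_cutProd {H : Finset Edge} (hH : IsEvenSubgraph H) (e : Edge) :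
    cutProd H (dualEnds e).1 * cutProd H (dualEnds e).2 = if e ∈ H then -1 else 1 := by
  rw [← prod_ite_eq_neg_one]
  obtain ⟨⟨x, y⟩, b⟩ := e
  cases b
  · rw [cutProd, cutProd, ← Finset.prod_mul_distrib]
    refine Finset.prod_congr rfl fun e' _ => ?_
    obtain ⟨⟨x', y'⟩, b'⟩ := e'
    cases b' <;> simp only [dualEnds, cutSign, Prod.mk.injEq] <;> split_ifs <;> first | rfl | grind
  · set s : Site → ℤˣ := fun v => if v.2 = y ∧ v.1 ≤ x then -1 else 1 with hs
    have hp : ∀ e' : Edge, cutSign (dualEnds ((x, y), true)).1 e' *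
        cutSign (dualEnds ((x, y), true)).2 e' =
          (if e' = ((x, y), true) then -1 else 1) * (s (ends e').1 * s (ends e').2) := by
      intro e'
      obtain ⟨⟨x', y'⟩, b'⟩ := e'
      cases b'
      · have hy : y' + 1 = y ↔ y' = y - 1 := by omega
        simp [dualEnds, cutSign, ends, hs, hy]
      · simp only [dualEnds, cutSign, ends, hs, Prod.mk.injEq, if_true, Bool.true_eq_false,
          if_false, false_and, and_true, one_mul]
        split_ifs <;> first | rfl | omega
    rw [cutProd, cutProd, ← Finset.prod_mul_distrib, Finset.prod_congr rfl fun e' _ => hp e',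
      Finset.prod_mul_distrib, hH s, mul_one]

theorem extend_of_mem {β : Type*} {S : Finset (ℤ × ℤ)} {c : β} {f : S → β} {x : ℤ × ℤ}
    (h : x ∈ S) : extend S c f x = f ⟨x, h⟩ := dif_pos h

theorem extend_of_notMem {β : Type*} {S : Finset (ℤ × ℤ)} {c : β} {f : S → β} {x : ℤ × ℤ}
    (h : x ∉ S) : extend S c f x = c := dif_neg h

theorem mem_sides_iff (e : Edge) (z : Face) :
    e ∈ sides z ↔ z = (dualEnds e).1 ∨ z = (dualEnds e).2 := by
  obtain ⟨⟨x, y⟩, b⟩ := e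
  obtain ⟨z₁, z₂⟩ := z
  cases b <;> simp [sides, dualEnds] <;> omega

theorem dualEnds_fst_ne_snd (e : Edge) : (dualEnds e).1 ≠ (dualEnds e).2 := by
  obtain ⟨⟨x, y⟩, b⟩ := e
  cases b <;> simp [dualEnds] <;> omega

theorem DiscreteDomain.mem_edges_iff (D : DiscreteDomain a) (e : Edge) :
    e ∈ D.edges ↔ (dualEnds e).1 ∈ D.faces ∨ (dualEnds e).2 ∈ D.faces := by
  simp only [DiscreteDomain.edges, Finset.mem_biUnion, mem_sides_iff]
  grind

theorem DiscreteDomain.ends_mem_sites (D : DiscreteDomain a) {e : Edge} (he : e ∈ D.edges) :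
    (ends e).1 ∈ D.sites ∧ (ends e).2 ∈ D.sites := by
  simp only [DiscreteDomain.edges, DiscreteDomain.sites, Finset.mem_biUnion] at he ⊢
  obtain ⟨z, hz, he⟩ := he
  refine ⟨⟨z, hz, ?_⟩, ⟨z, hz, ?_⟩⟩ <;>
  · obtain ⟨⟨x, y⟩, b⟩ := e
    obtain ⟨z₁, z₂⟩ := z
    cases b <;> simp [sides, corners, ends] at he ⊢ <;> omega

/-- The set of edges separating different spins. -/
def DiscreteDomain.contour (D : DiscreteDomain a) (t : D.faces → ℤˣ) : Finset Edge :=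
  D.edges.filter fun e =>
    extend D.faces 1 t (dualEnds e).1 * extend D.faces 1 t (dualEnds e).2 = -1

theorem prod_sides_coboundary (s : Site → ℤˣ) (z : Face) :
    ∏ e ∈ sides z, s (ends e).1 * s (ends e).2 = 1 := by
  obtain ⟨x, y⟩ := z
  rw [sides, Finset.prod_insert (by simp), Finset.prod_insert (by simp),
    Finset.prod_insert (by simp), Finset.prod_singleton]
  simp only [ends, if_true, Bool.false_eq_true, if_false]
  generalize s (x, y) = p, s (x + 1, y) = q, s (x, y + 1) = r, s (x + 1, y + 1) = w
  revert p q r w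
  decide

/-- The contours of a spin configuration form an even subgraph, since its faces with spin `-1`
have closed boundaries. -/
theorem DiscreteDomain.isEvenSubgraph_contour (D : DiscreteDomain a) (t : D.faces → ℤˣ) :
    IsEvenSubgraph (D.contour t) := by
  intro s
  set f : Edge → ℤˣ := fun e => s (ends e).1 * s (ends e).2 with hf
  -- the bilinear pairing of `±1` with itself
  let b : ℤˣ → ℤˣ → ℤˣ := fun u v => if u = -1 then v else 1
  have hb : ∀ u u' v, b (u * u') v = b u v * b u' v := by decide
  have hb' : ∀ v, b 1 v = 1 := by decide
  have hterm : ∀ e : Edge,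
      b (extend D.faces 1 t (dualEnds e).1 * extend D.faces 1 t (dualEnds e).2) (f e) =
        ∏ z ∈ D.faces, if e ∈ sides z then b (extend D.faces 1 t z) (f e) else 1 := by
    intro e
    have h₁ : ∀ w : Face, b (extend D.faces 1 t w) (f e) =
        ∏ z ∈ D.faces, if z = w then b (extend D.faces 1 t z) (f e) else 1 := by
      intro w
      rw [Finset.prod_ite_eq']
      split_ifs with h
      · rfl
      · rw [extend_of_notMem h, hb']
    rw [hb, h₁, h₁ (dualEnds e).2, ← Finset.prod_mul_distrib]
    refine Finset.prod_congr rfl fun z _ => ?_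
    have := dualEnds_fst_ne_snd e
    simp only [mem_sides_iff]
    grind
  rw [DiscreteDomain.contour, Finset.prod_filter]
  calc _ = ∏ e ∈ D.edges, ∏ z ∈ D.faces,
        if e ∈ sides z then b (extend D.faces 1 t z) (f e) else 1 :=
        Finset.prod_congr rfl fun e _ => hterm e
    _ = ∏ z ∈ D.faces, 1 := by
        rw [Finset.prod_comm]
        refine Finset.prod_congr rfl fun z hz => ?_
        have hsub : sides z ⊆ D.edges := fun e he => Finset.mem_biUnion.2 ⟨z, hz, he⟩
        rw [← Finset.prod_filter, Finset.filter_mem_eq_inter, Finset.inter_eq_right.2 hsub]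
        obtain h | h := Int.units_eq_one_or (extend D.faces 1 t z)
        · simp [h, b]
        · simp [h, b, hf, prod_sides_coboundary]
    _ = 1 := Finset.prod_const_one

/-- Spins outside the domain are `+1`, and an edge outside the domain has both adjacent faces
outside, so that contours describe all spin changes in the lattice. -/
theorem DiscreteDomain.mul_extend_eq_ite (D : DiscreteDomain a) (t : D.faces → ℤˣ) (e : Edge) :
    extend D.faces 1 t (dualEnds e).1 * extend D.faces 1 t (dualEnds e).2 =
      if e ∈ D.contour t then -1 else 1 := by
  by_cases he : e ∈ D.edges
  · simp only [DiscreteDomain.contour, Finset.mem_filter, he, true_and]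
    split_ifs with h
    · exact h
    · exact (Int.units_eq_one_or _).resolve_right h
  · have h : e ∉ D.contour t := fun h => he (Finset.mem_filter.1 h).1
    rw [DiscreteDomain.mem_edges_iff, not_or] at he
    rw [if_neg h, extend_of_notMem he.1, extend_of_notMem he.2, mul_one]

/-- A configuration of spins is determined by its contours: any two faces in the same row are
separated by vertical edges, and every row leaves the domain. -/
theorem DiscreteDomain.contour_injective (D : DiscreteDomain a) :
    Function.Injective D.contour := by
  intro t t' h
  have hstep : ∀ x y : ℤ, extend D.faces 1 t (x, y) * extend D.faces 1 t' (x, y) =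
      extend D.faces 1 t (x - 1, y) * extend D.faces 1 t' (x - 1, y) := by
    intro x y
    have h₁ := D.mul_extend_eq_ite t ((x, y), false)
    have h₂ := D.mul_extend_eq_ite t' ((x, y), false)
    rw [h, ← h₂] at h₁
    simp only [dualEnds, Bool.false_eq_true, if_false] at h₁
    generalize extend D.faces 1 t (x, y) = p at *
    generalize extend D.faces 1 t' (x, y) = q at *
    generalize extend D.faces 1 t (x - 1, y) = p' at *
    generalize extend D.faces 1 t' (x - 1, y) = q' at *
    revert p q p' q'
    decide
  have hall : ∀ (n : ℕ) (x y : ℤ), extend D.faces 1 t (x, y) * extend D.faces 1 t' (x, y) =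
      extend D.faces 1 t (x - n, y) * extend D.faces 1 t' (x - n, y) := by
    intro n x y
    induction n with
    | zero => simp
    | succ n ih =>
      rw [ih, hstep, Nat.cast_succ, sub_add_eq_sub_sub]
  funext ⟨⟨x, y⟩, hz⟩
  obtain ⟨n, hn⟩ : ∃ n : ℕ, (x - n, y) ∉ D.faces := by
    by_contra! hcon
    have hinj : Function.Injective fun n : ℕ => (x - n, y) := fun m n hmn => by simpa using hmn
    exact Set.infinite_of_injective_forall_mem hinj (s := (D.faces : Set Face))
      (fun n => hcon n) D.faces.finite_toSet
  have h₁ := hall n x y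
  rw [extend_of_notMem hn, extend_of_notMem hn, extend_of_mem hz, extend_of_mem hz, mul_one] at h₁
  rw [mul_eq_one_iff_eq_inv, Int.units_inv_eq_self] at h₁
  exact h₁

/-! ### Angles seen from the centre of a face -/

section Angles

open Complex

theorem exists_arg_div_add_arg_sub_arg {u v : ℂ} (hu : u ≠ 0) (hv : v ≠ 0) :
    ∃ k : ℤ, arg (v / u) + arg u - arg v = 2 * Real.pi * k := by
  have h := arg_div_coe_angle hv hu
  rw [← Real.Angle.coe_sub, Real.Angle.angle_eq_iff_two_pi_dvd_sub] at h
  obtain ⟨k, hk⟩ := h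
  exact ⟨k, by linarith⟩

theorem exp_half_arg_of_lt {u v : ℂ} (hu : u ≠ 0) (hv : v ≠ 0) (h : |arg v - arg u| < Real.pi) :
    exp (((arg (v / u) + arg u - arg v : ℝ) : ℂ) / 2 * I) = 1 := by
  obtain ⟨k, hk⟩ := exists_arg_div_add_arg_sub_arg hu hv
  have h₁ := neg_pi_lt_arg (v / u)
  have h₂ := arg_le_pi (v / u)
  rw [abs_lt] at h
  have hpi := Real.pi_pos
  have hk₁ : (k : ℝ) < 1 := by
    by_contra! hc
    nlinarith
  have hk₂ : (-1 : ℝ) < k := by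
    by_contra! hc
    nlinarith
  have hk₃ : k < 1 := by exact_mod_cast hk₁
  have hk₄ : -1 < k := by exact_mod_cast hk₂
  obtain rfl : k = 0 := by omega
  simp [hk]

theorem exp_half_arg_of_gt {u v : ℂ} (hu : u ≠ 0) (hv : v ≠ 0) (h : Real.pi < |arg v - arg u|) :
    exp (((arg (v / u) + arg u - arg v : ℝ) : ℂ) / 2 * I) = -1 := by
  obtain ⟨k, hk⟩ := exists_arg_div_add_arg_sub_arg hu hv
  have h₁ := neg_pi_lt_arg (v / u)
  have h₂ := arg_le_pi (v / u)
  have h₃ := neg_pi_lt_arg u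
  have h₄ := arg_le_pi u
  have h₅ := neg_pi_lt_arg v
  have h₆ := arg_le_pi v
  have hpi := Real.pi_pos
  have hk₁ : (k : ℝ) < 2 := by
    by_contra! hc
    nlinarith
  have hk₂ : (-2 : ℝ) < k := by
    by_contra! hc
    nlinarith
  have hk₃ : k ≠ 0 := by
    rintro rfl
    rw [lt_abs] at h
    simp only [Int.cast_zero, mul_zero] at hk
    rcases h with h | h <;> linarith
  have hk₄ : k < 2 := by exact_mod_cast hk₁
  have hk₅ : -2 < k := by exact_mod_cast hk₂
  obtain rfl | rfl : k = 1 ∨ k = -1 := by omega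
  · rw [hk, ← exp_pi_mul_I]
    congr 1
    push_cast
    ring
  · rw [hk, show ((2 * Real.pi * ((-1 : ℤ) : ℝ) : ℝ) : ℂ) / 2 * I = -(Real.pi * I) by
      push_cast
      ring, exp_neg, exp_pi_mul_I]
    norm_num

theorem div_mem_slitPlane {u v : ℂ} (hu : u ≠ 0) (hv : v ≠ 0) (h : |arg v - arg u| ≠ Real.pi) :
    v / u ∈ slitPlane := by
  rw [mem_slitPlane_iff_arg]
  refine ⟨fun hpi => h ?_, div_ne_zero hv hu⟩
  obtain ⟨k, hk⟩ := exists_arg_div_add_arg_sub_arg hu hv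
  have h₃ := neg_pi_lt_arg u
  have h₄ := arg_le_pi u
  have h₅ := neg_pi_lt_arg v
  have h₆ := arg_le_pi v
  have hp := Real.pi_pos
  rw [hpi] at hk
  have hk₁ : (k : ℝ) < 2 := by
    by_contra! hc
    nlinarith
  have hk₂ : (-1 : ℝ) < k := by
    by_contra! hc
    nlinarith
  have hk₃ : k < 2 := by exact_mod_cast hk₁
  have hk₄ : -1 < k := by exact_mod_cast hk₂
  obtain rfl | rfl : k = 0 ∨ k = 1 := by omega
  · rw [abs_of_nonneg] <;> simp at hk <;> linarith
  · rw [abs_of_nonpos] <;> simp at hk <;> linarith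

theorem arg_mem_of_im_pos {w : ℂ} (h : 0 < w.im) : 0 < arg w ∧ arg w < Real.pi := by
  refine ⟨lt_of_le_of_ne (arg_nonneg_iff.2 h.le) fun h0 => ?_, arg_lt_pi_iff.2 (Or.inr h.ne')⟩
  exact h.ne' (arg_eq_zero_iff.1 h0.symm).2

theorem abs_arg_sub_arg_lt_of_im_mul_pos {u v : ℂ} (h : 0 < u.im * v.im) :
    |arg v - arg u| < Real.pi := by
  rw [abs_lt]
  rcases mul_pos_iff.1 h with ⟨hu, hv⟩ | ⟨hu, hv⟩
  · have := arg_mem_of_im_pos hu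
    have := arg_mem_of_im_pos hv
    constructor <;> linarith
  · have := arg_neg_iff.2 hu
    have := arg_neg_iff.2 hv
    have := neg_pi_lt_arg u
    have := neg_pi_lt_arg v
    constructor <;> linarith

theorem abs_arg_sub_arg_lt_of_re_pos {u v : ℂ} (hu : 0 < u.re) (hv : 0 < v.re) :
    |arg v - arg u| < Real.pi := by
  have h₁ := abs_lt.1 (abs_arg_lt_pi_div_two_iff.2 (Or.inl hu))
  have h₂ := abs_lt.1 (abs_arg_lt_pi_div_two_iff.2 (Or.inl hv))
  rw [abs_lt]
  constructor <;> linarith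

theorem pi_lt_abs_arg_sub_arg {u v : ℂ} (hu : u.re < 0) (hv : v.re < 0) (hui : u.im < 0)
    (hvi : 0 < v.im) : Real.pi < |arg v - arg u| := by
  have h₁ : ¬ arg v ≤ Real.pi / 2 := fun h => by
    rcases arg_le_pi_div_two_iff.1 h with h | h <;> linarith
  have h₂ : ¬ -(Real.pi / 2) ≤ arg u := fun h => by
    rcases neg_pi_div_two_le_arg_iff.1 h with h | h <;> linarith
  rw [lt_abs]
  left
  linarith

theorem point_sub_centre (a : ℝ) (x : Site) (z : Face) :
    point a x - centre a z = ⟨a * ((x.1 - z.1 : ℤ) - 1 / 2), a * ((x.2 - z.2 : ℤ) - 1 / 2)⟩ := by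
  apply Complex.ext <;> simp [point, centre] <;> ring

theorem intCast_sub_half_pos {n : ℤ} (h : 0 < n) : (0 : ℝ) < n - 1 / 2 := by
  have : (1 : ℝ) ≤ n := by exact_mod_cast h
  linarith

theorem intCast_sub_half_neg {n : ℤ} (h : n ≤ 0) : (n : ℝ) - 1 / 2 < 0 := by
  have : (n : ℝ) ≤ 0 := by exact_mod_cast h
  linarith

theorem intCast_sub_half_mul_self_pos (n : ℤ) : (0 : ℝ) < (n - 1 / 2) * (n - 1 / 2) := by
  rcases lt_or_ge 0 n with h | h
  · exact mul_pos (intCast_sub_half_pos h) (intCast_sub_half_pos h)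
  · exact mul_pos_of_neg_of_neg (intCast_sub_half_neg h) (intCast_sub_half_neg h)

theorem point_ne_centre (ha : 0 < a) (x : Site) (z : Face) : point a x ≠ centre a z := by
  intro h
  have h₁ := point_sub_centre a x z
  rw [sub_eq_zero.2 h] at h₁
  have h₂ := congrArg Complex.re h₁
  have h₃ := intCast_sub_half_mul_self_pos (x.1 - z.1)
  simp only [zero_re, zero_eq_mul, ha.ne', false_or] at h₂
  rw [h₂] at h₃
  simp at h₃

theorem abs_arg_sub_arg_ends (ha : 0 < a) (z : Face) (e : Edge) :
    (cutSign z e = 1 ∧ |arg (point a (ends e).2 - centre a z) -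
      arg (point a (ends e).1 - centre a z)| < Real.pi) ∨
    (cutSign z e = -1 ∧ Real.pi < |arg (point a (ends e).2 - centre a z) -
      arg (point a (ends e).1 - centre a z)|) := by
  obtain ⟨⟨x, y⟩, b⟩ := e
  obtain ⟨z₁, z₂⟩ := z
  rw [point_sub_centre, point_sub_centre]
  have hsame : ∀ m n : ℤ, (0 < m ∧ 0 < n) ∨ (m ≤ 0 ∧ n ≤ 0) →
      0 < (a * ((m : ℝ) - 1 / 2)) * (a * ((n : ℝ) - 1 / 2)) := by
    rintro m n (⟨hm, hn⟩ | ⟨hm, hn⟩)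
    · exact mul_pos (mul_pos ha (intCast_sub_half_pos hm)) (mul_pos ha (intCast_sub_half_pos hn))
    · exact mul_pos_of_neg_of_neg (mul_neg_of_pos_of_neg ha (intCast_sub_half_neg hm))
        (mul_neg_of_pos_of_neg ha (intCast_sub_half_neg hn))
  cases b
  · by_cases hy : y = z₂
    · by_cases hx : x ≤ z₁
      · refine Or.inr ⟨by simp [cutSign, hy, hx], ?_⟩
        simp only [ends, Bool.false_eq_true, if_false]
        refine pi_lt_abs_arg_sub_arg ?_ ?_ ?_ ?_
        · exact mul_neg_of_pos_of_neg ha (intCast_sub_half_neg (by omega))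
        · exact mul_neg_of_pos_of_neg ha (intCast_sub_half_neg (by omega))
        · exact mul_neg_of_pos_of_neg ha (intCast_sub_half_neg (by omega))
        · exact mul_pos ha (intCast_sub_half_pos (by omega))
      · refine Or.inl ⟨by simp [cutSign, hx], ?_⟩
        simp only [ends, Bool.false_eq_true, if_false]
        exact abs_arg_sub_arg_lt_of_re_pos (mul_pos ha (intCast_sub_half_pos (by omega)))
          (mul_pos ha (intCast_sub_half_pos (by omega)))
    · refine Or.inl ⟨by simp [cutSign, hy], ?_⟩
      simp only [ends, Bool.false_eq_true, if_false]
      exact abs_arg_sub_arg_lt_of_im_mul_pos (hsame _ _ (by omega))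
  · refine Or.inl ⟨by simp [cutSign], ?_⟩
    simp only [ends, if_true]
    exact abs_arg_sub_arg_lt_of_im_mul_pos (hsame _ _ (by omega))

/-- The half angle swept by a step along an edge agrees with the change of half the principal
argument, except that a sign appears if the edge crosses the cut. -/
theorem exp_half_arg_eq_cutSign (ha : 0 < a) (z : Face) {e : Edge} {x y : Site}
    (h : ends e = (x, y) ∨ ends e = (y, x)) :
    exp (((arg ((point a y - centre a z) / (point a x - centre a z)) +
      arg (point a x - centre a z) - arg (point a y - centre a z) : ℝ) : ℂ) / 2 * I) =
      ((cutSign z e : ℤ) : ℂ) := by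
  have hx := sub_ne_zero.2 (point_ne_centre ha x z)
  have hy := sub_ne_zero.2 (point_ne_centre ha y z)
  have key := abs_arg_sub_arg_ends ha z e
  have key' : (cutSign z e = 1 ∧
        |arg (point a y - centre a z) - arg (point a x - centre a z)| < Real.pi) ∨
      (cutSign z e = -1 ∧
        Real.pi < |arg (point a y - centre a z) - arg (point a x - centre a z)|) := by
    rcases h with h | h
    · rwa [h] at key
    · rwa [h, abs_sub_comm] at key
  rcases key' with ⟨h₁, h₂⟩ | ⟨h₁, h₂⟩
  · rw [exp_half_arg_of_lt hx hy h₂, h₁]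
    simp
  · rw [exp_half_arg_of_gt hx hy h₂, h₁]
    simp

/-- The edge of the lattice traversed by a step of a walk. -/
theorem DiscreteDomain.exists_edge {D : DiscreteDomain a} (d : D.graph.Dart) :
    ∃ e ∈ D.edges, ends e = (d.fst.1, d.snd.1) ∨ ends e = (d.snd.1, d.fst.1) := d.adj

end Angles

/-! ### The parity of winding numbers -/

/-- The edge of the lattice traversed by a step of a walk. -/
def DiscreteDomain.dartEdge {D : DiscreteDomain a} (d : D.graph.Dart) : Edge :=
  (DiscreteDomain.exists_edge d).choose

theorem DiscreteDomain.dartEdge_spec {D : DiscreteDomain a} (d : D.graph.Dart) :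
    D.dartEdge d ∈ D.edges ∧
      (ends (D.dartEdge d) = (d.fst.1, d.snd.1) ∨ ends (D.dartEdge d) = (d.snd.1, d.fst.1)) :=
  (DiscreteDomain.exists_edge d).choose_spec

/-- Along a walk, half of the total angle is the change of half of the principal argument, up to a
sign for every crossing of the cut. -/
theorem exp_half_totalAngle (ha : 0 < a) (z : Face) {D : DiscreteDomain a} {x y : D.sites}
    (p : D.graph.Walk x y) :
    Complex.exp ((totalAngle p (centre a z) : ℂ) / 2 * Complex.I) *
        Complex.exp ((Complex.arg (point a x - centre a z) : ℂ) / 2 * Complex.I) =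
      (((p.darts.map fun d => cutSign z (D.dartEdge d)).prod : ℤ) : ℂ) *
        Complex.exp ((Complex.arg (point a y - centre a z) : ℂ) / 2 * Complex.I) := by
  induction p with
  | nil => simp [totalAngle]
  | @cons u v w h p ih =>
    have hstep : totalAngle (SimpleGraph.Walk.cons h p) (centre a z) =
        Complex.arg ((point a v.1 - centre a z) / (point a u.1 - centre a z)) +
          totalAngle p (centre a z) := by
      simp [totalAngle]
    have hexp := exp_half_arg_eq_cutSign ha z (D.dartEdge_spec ⟨(u, v), h⟩).2
    rw [SimpleGraph.Walk.darts_cons, List.map_cons, List.prod_cons, Units.val_mul, Int.cast_mul,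
      mul_assoc, ← ih, ← hexp, hstep, ← Complex.exp_add, ← Complex.exp_add, ← Complex.exp_add]
    congr 1
    push_cast
    ring

/-- The parity of the winding number of a loop is that of its number of crossings of the cut. -/
theorem negOnePow_windingNumber (ha : 0 < a) (z : Face) {D : DiscreteDomain a} {x : D.sites}
    (p : D.graph.Walk x x) :
    (windingNumber p (centre a z)).negOnePow =
      (p.darts.map fun d => cutSign z (D.dartEdge d)).prod := by
  have h := mul_right_cancel₀ (Complex.exp_ne_zero _) (exp_half_totalAngle ha z p)
  rw [← windingNumber_mul_two_pi p (centre a z) fun w => point_ne_centre ha w z] at h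
  have h₁ : ((((windingNumber p (centre a z) : ℝ) * (2 * Real.pi) : ℝ) : ℂ) / 2 * Complex.I) =
      (windingNumber p (centre a z) : ℂ) * (Real.pi * Complex.I) := by
    push_cast
    ring
  rw [h₁, Complex.exp_int_mul, Complex.exp_pi_mul_I, ← Int.cast_negOnePow] at h
  exact Units.ext (by exact_mod_cast h)

/-! ### Cuts ending outside a simply connected domain -/

section Lifting

open scoped unitInterval

/-- A map from a simply connected space lifts to a covering space, continuously along each path.
(The space need not be locally path connected, so that the lift may fail to be continuous.) -/
theorem exists_lift_along_paths {A X E : Type*} [TopologicalSpace A] [TopologicalSpace X]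
    [TopologicalSpace E] [SimplyConnectedSpace A] {p : E → X} (cov : IsCoveringMap p)
    (hp : Function.Surjective p) (f : C(A, X)) :
    ∃ h : A → E, (∀ x, p (h x) = f x) ∧
      ∀ (x y : A) (γ : Path x y) (Γ : C(I, E)), p ∘ Γ = f ∘ γ → Γ 0 = h x → Γ 1 = h y := by
  obtain ⟨x₀⟩ : Nonempty A := inferInstance
  obtain ⟨e₀, he₀⟩ := hp (f x₀)
  let P : ∀ x : A, Path x₀ x := fun x => (PathConnectedSpace.joined x₀ x).somePath
  let Q : ∀ x : A, Path (f x₀) (f x) := fun x => (P x).map f.continuous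
  have hQ : ∀ x, (Q x : C(I, X)) 0 = p e₀ := fun x => (Q x).source.trans he₀.symm
  refine ⟨fun x => cov.liftPath (Q x) e₀ (hQ x) 1, fun x => ?_, fun x y γ Γ hΓ h0 => ?_⟩
  · have := congrFun (cov.liftPath_lifts (Q x) e₀ (hQ x)) 1
    simpa using this
  · let γ' : Path (f x) (f y) := γ.map f.continuous
    have hhom : (((Q x).trans γ' : Path _ _) : C(I, X)).HomotopicRel (Q y : C(I, X)) {0, 1} := by
      have h₁ : ((P x).trans γ).Homotopic (P y) := SimplyConnectedSpace.paths_homotopic _ _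
      have h₂ := h₁.map f
      rw [Path.map_trans] at h₂
      exact h₂
    have hsrc : (((Q x).trans γ' : Path _ _) : C(I, X)) 0 = p e₀ := by simp [he₀]
    have h₁ := cov.liftPath_apply_one_eq_of_homotopicRel hhom e₀ hsrc (hQ y)
    dsimp only
    rw [← h₁]
    have h₂ := cov.liftPath_trans he₀.symm (Q x) γ'
    rw [h₂]
    have h₃ : Γ = cov.liftPath γ' (cov.liftPath (Q x) e₀ (hQ x) 1) (by
        have := congrFun (cov.liftPath_lifts (Q x) e₀ (hQ x)) 1
        simpa using this.symm) :=
      (cov.eq_liftPath_iff' _).2 ⟨hΓ, h0⟩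
    simp [← h₃]

theorem segment_subset_square (ha : 0 < a) {f : Face} {e : Edge} (he : e ∈ sides f) {t : ℝ}
    (ht : t ∈ Set.Icc (0 : ℝ) 1) :
    point a (ends e).1 + t * (point a (ends e).2 - point a (ends e).1) ∈ square a f := by
  obtain ⟨⟨x, y⟩, b⟩ := e
  obtain ⟨z₁, z₂⟩ := f
  obtain ⟨h0, h1⟩ := ht
  have h₂ : 0 ≤ t * a := by positivity
  have h₃ : t * a ≤ a := by nlinarith
  simp only [sides, Finset.mem_insert, Finset.mem_singleton, Prod.mk.injEq] at he
  cases b <;> simp at he <;> rcases he with ⟨rfl, rfl⟩ | ⟨rfl, rfl⟩ <;>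
    refine ⟨?_, ?_, ?_, ?_⟩ <;> simp [ends, point] <;> nlinarith

theorem centre_notMem_square (ha : 0 < a) {z f : Face} (hzf : z ≠ f) :
    centre a z ∉ square a f := by
  rintro ⟨h₁, h₂, h₃, h₄⟩
  simp only [centre] at h₁ h₂ h₃ h₄
  have k₁ := le_of_mul_le_mul_left h₁ ha
  have k₂ := le_of_mul_le_mul_left h₂ ha
  have k₃ := le_of_mul_le_mul_left h₃ ha
  have k₄ := le_of_mul_le_mul_left h₄ ha
  have key : ∀ m n : ℤ, (m : ℝ) ≤ n + 1 / 2 → (n : ℝ) + 1 / 2 ≤ m + 1 → n = m := by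
    intro m n h h'
    have i₁ : (m : ℝ) < (n + 1 : ℤ) := by push_cast; linarith
    have i₂ : (n : ℝ) < (m + 1 : ℤ) := by push_cast; linarith
    have j₁ : m < n + 1 := by exact_mod_cast i₁
    have j₂ : n < m + 1 := by exact_mod_cast i₂
    omega
  exact hzf (Prod.ext (key _ _ k₁ k₂) (key _ _ k₃ k₄))

/-- If `z` is not a face of a simply connected domain, then the sign of the cut at `z` is the
coboundary of a function on the sites: a logarithm of `w - centre a z` exists along all paths in
the domain, and half of it differs from half of the principal logarithm by `0` or `iπ` modulo
`2πi`. -/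
theorem DiscreteDomain.exists_cutSign_eq_coboundary (ha : 0 < a) (D : DiscreteDomain a) {z : Face}
    (hz : z ∉ D.faces) :
    ∃ s : Site → ℤˣ, ∀ e ∈ D.edges, cutSign z e = s (ends e).1 * s (ends e).2 := by
  classical
  set X : Set ℂ := ⋃ f ∈ D.faces, square a f with hX
  have : SimplyConnectedSpace X := D.simplyConnected
  set c := centre a z with hc
  have hcX : ∀ w ∈ X, w - c ≠ 0 := by
    intro w hw h
    rw [sub_eq_zero.1 h] at hw
    simp only [hX, Set.mem_iUnion] at hw
    obtain ⟨f, hf, hw⟩ := hw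
    exact centre_notMem_square ha (by rintro rfl; exact hz hf) hw
  let F : C(X, {w : ℂ // w ≠ 0}) := ⟨fun w => ⟨w.1 - c, hcX w.1 w.2⟩, by fun_prop⟩
  obtain ⟨h, hh, hpath⟩ := exists_lift_along_paths Complex.isCoveringMap_exp
    (fun w => ⟨Complex.log w.1, Subtype.ext (Complex.exp_log w.2)⟩) F
  have hh' : ∀ w : X, Complex.exp (h w) = w.1 - c := fun w => congrArg Subtype.val (hh w)
  -- the ratio of the two square roots of `w - c`
  let ρ : X → ℂ := fun w => Complex.exp ((h w - Complex.log (w.1 - c)) / 2)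
  have hρ : ∀ w, ρ w = 1 ∨ ρ w = -1 := by
    intro w
    rw [← sq_eq_one_iff, ← Complex.exp_nat_mul]
    rw [show ((2 : ℕ) : ℂ) * ((h w - Complex.log (w.1 - c)) / 2) = h w - Complex.log (w.1 - c) by
      push_cast; ring, Complex.exp_sub, hh', Complex.exp_log (hcX w.1 w.2),
      div_self (hcX w.1 w.2)]
  let s : Site → ℤˣ := fun x => if hx : point a x ∈ X then (if ρ ⟨point a x, hx⟩ = 1 then 1 else -1)
    else 1
  have hs : ∀ (x : Site) (hx : point a x ∈ X), ((s x : ℤ) : ℂ) = ρ ⟨point a x, hx⟩ := by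
    intro x hx
    simp only [s, dif_pos hx]
    split_ifs with h1
    · simp [h1]
    · simp [(hρ ⟨point a x, hx⟩).resolve_left h1]
  refine ⟨s, fun e he => ?_⟩
  simp only [DiscreteDomain.edges, Finset.mem_biUnion] at he
  obtain ⟨f, hf, he⟩ := he
  set u := point a (ends e).1 with hu
  set v := point a (ends e).2 with hv
  have hseg : ∀ t : I, u + (t : ℝ) * (v - u) ∈ X := fun t =>
    Set.mem_biUnion hf (segment_subset_square ha he t.2)
  have huX : u ∈ X := by simpa using hseg 0
  have hvX : v ∈ X := by simpa using hseg 1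
  have hu0 := hcX u huX
  have hv0 := hcX v hvX
  let γ : Path (⟨u, huX⟩ : X) ⟨v, hvX⟩ :=
    { toFun := fun t => ⟨u + (t : ℝ) * (v - u), hseg t⟩
      continuous_toFun := by fun_prop
      source' := by simp
      target' := by simp }
  have hslit : (v - c) / (u - c) ∈ Complex.slitPlane := by
    refine div_mem_slitPlane hu0 hv0 ?_
    rcases abs_arg_sub_arg_ends ha z e with h | h
    · exact h.2.ne
    · exact h.2.ne'
  have hslit' : ∀ t : I, 1 + ((t : ℝ) : ℂ) * ((v - c) / (u - c) - 1) ∈ Complex.slitPlane := by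
    intro t
    have := Complex.starConvex_one_slitPlane.add_smul_sub_mem hslit t.2.1 t.2.2
    simpa using this
  -- the lift of the segment that starts at `h u`
  let Γ : C(I, ℂ) := ⟨fun t => h ⟨u, huX⟩ + Complex.log (1 + ((t : ℝ) : ℂ) *
    ((v - c) / (u - c) - 1)), by
      refine continuous_const.add (Continuous.clog (by fun_prop) hslit')⟩
  have hΓ := hpath _ _ γ Γ (by
    funext t
    apply Subtype.ext
    change Complex.exp (h ⟨u, huX⟩ + Complex.log (1 + ((t : ℝ) : ℂ) * ((v - c) / (u - c) - 1))) =
      u + (t : ℝ) * (v - u) - c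
    rw [Complex.exp_add, Complex.exp_log (Complex.slitPlane_ne_zero (hslit' t)), hh']
    dsimp only
    field_simp
    ring) (by simp [Γ])
  have hΓ' : h ⟨v, hvX⟩ = h ⟨u, huX⟩ + Complex.log ((v - c) / (u - c)) := by
    rw [← hΓ]
    simp [Γ]
  have hcut := exp_half_arg_eq_cutSign ha z (e := e) (x := (ends e).1) (y := (ends e).2)
    (Or.inl rfl)
  rw [← hu, ← hv, ← hc] at hcut
  have hlog : ((Complex.arg ((v - c) / (u - c)) + Complex.arg (u - c) -
      Complex.arg (v - c) : ℝ) : ℂ) / 2 * Complex.I =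
      (Complex.log ((v - c) / (u - c)) + Complex.log (u - c) - Complex.log (v - c)) / 2 := by
    have hnu : ‖u - c‖ ≠ 0 := norm_ne_zero_iff.2 hu0
    have hnv : ‖v - c‖ ≠ 0 := norm_ne_zero_iff.2 hv0
    simp only [Complex.log, norm_div, Real.log_div hnv hnu]
    push_cast
    ring
  rw [hlog] at hcut
  have hmul : ((cutSign z e : ℤ) : ℂ) * ρ ⟨u, huX⟩ = ρ ⟨v, hvX⟩ := by
    rw [← hcut]
    change _ * Complex.exp ((h ⟨u, huX⟩ - Complex.log (u - c)) / 2) =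
      Complex.exp ((h ⟨v, hvX⟩ - Complex.log (v - c)) / 2)
    rw [← Complex.exp_add, hΓ']
    congr 1
    ring
  rw [← hs _ huX, ← hs _ hvX] at hmul
  have hmul' : cutSign z e * s (ends e).1 = s (ends e).2 := Units.ext (by exact_mod_cast hmul)
  rw [← hmul', mul_comm (cutSign z e), ← mul_assoc, ← sq, Int.units_sq, one_mul]

end Lifting

/-- The cut of a face outside the domain is crossed an even number of times by an even subgraph. -/
theorem DiscreteDomain.cutProd_eq_one (ha : 0 < a) (D : DiscreteDomain a) {H : Finset Edge}
    (hHD : H ⊆ D.edges) (hH : IsEvenSubgraph H) {z : Face} (hz : z ∉ D.faces) :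
    cutProd H z = 1 := by
  obtain ⟨s, hs⟩ := D.exists_cutSign_eq_coboundary ha hz
  rw [← hH s]
  exact Finset.prod_congr rfl fun e he => hs e (hHD he)

/-! ### High temperature expansion and Kramers-Wannier duality -/

/-- In a simply connected domain every even subgraph consists of the contours of a spin
configuration on the faces. -/
theorem DiscreteDomain.contour_cutProd (ha : 0 < a) (D : DiscreteDomain a) {H : Finset Edge}
    (hHD : H ⊆ D.edges) (hH : IsEvenSubgraph H) :
    D.contour (fun z => cutProd H z.1) = H := by
  have hext : ∀ z, extend D.faces 1 (fun z : D.faces => cutProd H z.1) z = cutProd H z := by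
    intro z
    by_cases hz : z ∈ D.faces
    · rw [extend_of_mem hz]
    · rw [extend_of_notMem hz, D.cutProd_eq_one ha hHD hH hz]
  ext e
  simp only [DiscreteDomain.contour, Finset.mem_filter, hext, cutProd_mul_cutProd hH]
  constructor
  · rintro ⟨-, h⟩
    by_contra he
    rw [if_neg he] at h
    exact absurd h (by decide)
  · intro he
    exact ⟨hHD he, if_pos he⟩

theorem DiscreteDomain.contour_subset (D : DiscreteDomain a) (t : D.faces → ℤˣ) :
    D.contour t ⊆ D.edges := Finset.filter_subset _ _

theorem DiscreteDomain.cutProd_contour (ha : 0 < a) (D : DiscreteDomain a) (t : D.faces → ℤˣ)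
    (z : D.faces) : cutProd (D.contour t) z.1 = t z :=
  congrFun (D.contour_injective
    (D.contour_cutProd ha (D.contour_subset t) (D.isEvenSubgraph_contour t))) z

/-- The product of the spins at the two end points of an edge. -/
def bond {S : Finset (ℤ × ℤ)} (i : Edge → (ℤ × ℤ) × (ℤ × ℤ)) (s : S → ℤˣ) (e : Edge) : ℤˣ :=
  extend S 1 s (i e).1 * extend S 1 s (i e).2

theorem extend_mul {S : Finset (ℤ × ℤ)} (s s' : S → ℤˣ) (x : ℤ × ℤ) :
    extend S 1 (s * s') x = extend S 1 s x * extend S 1 s' x := by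
  by_cases h : x ∈ S
  · simp [extend_of_mem h]
  · simp [extend_of_notMem h]

theorem bond_mul {S : Finset (ℤ × ℤ)} (i : Edge → (ℤ × ℤ) × (ℤ × ℤ)) (s s' : S → ℤˣ) (e : Edge) :
    bond i (s * s') e = bond i s e * bond i s' e := by
  rw [bond, extend_mul, extend_mul, mul_mul_mul_comm]
  rfl

theorem card_spins (S : Finset (ℤ × ℤ)) : Fintype.card (S → ℤˣ) = 2 ^ S.card := by
  simp

/-- The orthogonality relation behind the high temperature expansion: only even subgraphs
contribute. -/
theorem DiscreteDomain.sum_prod_bond [DecidablePred IsEvenSubgraph] (D : DiscreteDomain a)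
    {H : Finset Edge} (hHD : H ⊆ D.edges) :
    ∑ s : D.sites → ℤˣ, ((∏ e ∈ H, bond ends s e : ℤˣ) : ℤ) =
      if IsEvenSubgraph H then 2 ^ D.sites.card else 0 := by
  split_ifs with hH
  · have h : ∀ s : D.sites → ℤˣ, ∏ e ∈ H, bond ends s e = 1 := fun s => hH (extend D.sites 1 s)
    simp [h]
  · obtain ⟨s₁, hs₁⟩ : ∃ s₁ : D.sites → ℤˣ, ∏ e ∈ H, bond ends s₁ e = -1 := by
      by_contra! hcon
      refine hH fun s => ?_
      have h := (Int.units_eq_one_or _).resolve_right (hcon fun x => s x.1)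
      rw [← h]
      refine Finset.prod_congr rfl fun e he => ?_
      obtain ⟨h₁, h₂⟩ := D.ends_mem_sites (hHD he)
      rw [bond, extend_of_mem h₁, extend_of_mem h₂]
    have h := Equiv.sum_comp (Equiv.mulLeft s₁)
      fun s : D.sites → ℤˣ => ((∏ e ∈ H, bond ends s e : ℤˣ) : ℤ)
    simp only [Equiv.coe_mulLeft, bond_mul, Finset.prod_mul_distrib, hs₁,
      Units.val_neg, neg_mul, one_mul, Finset.sum_neg_distrib] at h
    linarith

/-- The high temperature expansion on the sites is the low temperature expansion on the faces. -/
theorem DiscreteDomain.sum_prod_one_add_bond (ha : 0 < a) (D : DiscreteDomain a) (c : Edge → ℝ) :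
    ∑ s : D.sites → ℤˣ, ∏ e ∈ D.edges, (1 + c e * ((bond ends s e : ℤ) : ℝ)) =
      2 ^ D.sites.card * ∑ t : D.faces → ℤˣ, ∏ e ∈ D.contour t, c e := by
  classical
  simp only [Finset.prod_one_add, Finset.prod_mul_distrib]
  rw [Finset.sum_comm]
  have h₁ : ∀ H ∈ D.edges.powerset, ∑ s : D.sites → ℤˣ,
      (∏ e ∈ H, c e) * ∏ e ∈ H, ((bond ends s e : ℤ) : ℝ) =
        if IsEvenSubgraph H then 2 ^ D.sites.card * ∏ e ∈ H, c e else 0 := by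
    intro H hH
    rw [← Finset.mul_sum]
    have h := congrArg (Int.cast : ℤ → ℝ) (D.sum_prod_bond (Finset.mem_powerset.1 hH))
    push_cast [Units.coe_prod] at h
    rw [h]
    split_ifs
    · ring
    · simp
  rw [Finset.sum_congr rfl h₁, ← Finset.sum_filter, Finset.mul_sum]
  symm
  refine Finset.sum_bij (fun t _ => D.contour t) (fun t _ => ?_)
    (fun t _ t' _ h => D.contour_injective h) (fun H hH => ?_) fun _ _ => rfl
  · rw [Finset.mem_filter, Finset.mem_powerset]
    exact ⟨D.contour_subset t, D.isEvenSubgraph_contour t⟩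
  · rw [Finset.mem_filter, Finset.mem_powerset] at hH
    exact ⟨_, Finset.mem_univ _, D.contour_cutProd ha hH.1 hH.2⟩

/-- The edge signs of a gauge field with flux `-1` through the faces in `B`. -/
def gauge (B : Finset Face) (e : Edge) : ℤˣ := ∏ z ∈ B, cutSign z e

theorem DiscreteDomain.prod_contour_gauge (ha : 0 < a) (D : DiscreteDomain a) (t : D.faces → ℤˣ)
    (B : Finset D.faces) :
    ∏ e ∈ D.contour t, gauge (B.map (Function.Embedding.subtype _)) e = ∏ z ∈ B, t z := by
  simp only [gauge, Finset.prod_map, Function.Embedding.subtype_apply]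
  rw [Finset.prod_comm]
  exact Finset.prod_congr rfl fun z _ => D.cutProd_contour ha t z

/-- The partition function of the free Ising model with couplings twisted by a gauge field, without
the factor `exp (-∑ J)`. -/
def DiscreteDomain.twistedSum (D : DiscreteDomain a) (η : Edge → ℤˣ) (J : Edge → ℝ) : ℝ :=
  ∑ s : D.sites → ℤˣ, Real.exp (∑ e ∈ D.edges, ((η e : ℤ) : ℝ) * J e * ((bond ends s e : ℤ) : ℝ))

theorem DiscreteDomain.twistedSum_pos (D : DiscreteDomain a) (η : Edge → ℤˣ) (J : Edge → ℝ) :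
    0 < D.twistedSum η J :=
  Finset.sum_pos (fun _ _ => Real.exp_pos _) Finset.univ_nonempty

theorem exp_mul_units (J : ℝ) (u : ℤˣ) :
    Real.exp (J * ((u : ℤ) : ℝ)) = Real.cosh J * (1 + Real.tanh J * ((u : ℤ) : ℝ)) := by
  have h := (Real.cosh_pos J).ne'
  rw [Real.tanh_eq_sinh_div_cosh]
  obtain rfl | rfl := Int.units_eq_one_or u
  · simp only [Units.val_one, Int.cast_one, mul_one]
    rw [mul_add, mul_div_cancel₀ _ h, mul_one, Real.cosh_add_sinh]
  · simp only [Units.val_neg, Units.val_one, Int.cast_neg, Int.cast_one, mul_neg, mul_one]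
    rw [mul_add, mul_neg, mul_div_cancel₀ _ h, mul_one, ← sub_eq_add_neg, Real.cosh_sub_sinh]

/-- Kramers-Wannier duality: twisting the couplings by a gauge field with flux `-1` through the
faces in `B` inserts the product of the dual spins in `B`. -/
theorem DiscreteDomain.twistedSum_gauge (ha : 0 < a) (D : DiscreteDomain a) (J : Edge → ℝ)
    (B : Finset D.faces) :
    D.twistedSum (gauge (B.map (Function.Embedding.subtype _))) J =
      (∏ e ∈ D.edges, Real.cosh (J e)) * 2 ^ D.sites.card *
        ∑ t : D.faces → ℤˣ, ((∏ z ∈ B, t z : ℤˣ) : ℤ) * ∏ e ∈ D.contour t, Real.tanh (J e) := by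
  set η := gauge (B.map (Function.Embedding.subtype _)) with hη
  have h₁ : ∀ s : D.sites → ℤˣ,
      Real.exp (∑ e ∈ D.edges, ((η e : ℤ) : ℝ) * J e * ((bond ends s e : ℤ) : ℝ)) =
      (∏ e ∈ D.edges, Real.cosh (J e)) *
        ∏ e ∈ D.edges, (1 + ((η e : ℤ) : ℝ) * Real.tanh (J e) * ((bond ends s e : ℤ) : ℝ)) := by
    intro s
    rw [Real.exp_sum, ← Finset.prod_mul_distrib]
    refine Finset.prod_congr rfl fun e _ => ?_
    have h := exp_mul_units (J e) (η e * bond ends s e)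
    push_cast at h
    rw [show ((η e : ℤ) : ℝ) * J e * ((bond ends s e : ℤ) : ℝ) =
      J e * (((η e : ℤ) : ℝ) * ((bond ends s e : ℤ) : ℝ)) by ring, h]
    ring
  rw [DiscreteDomain.twistedSum, Finset.sum_congr rfl fun s _ => h₁ s, ← Finset.mul_sum,
    D.sum_prod_one_add_bond ha, ← mul_assoc]
  congr 1
  refine Finset.sum_congr rfl fun t _ => ?_
  rw [Finset.prod_mul_distrib, ← D.prod_contour_gauge ha t B]
  push_cast [Units.coe_prod]
  rfl

/-! ### The weights of the two Ising models -/

theorem isingEnergy_eq_sum_bond (S : Finset (ℤ × ℤ)) (E : Finset Edge)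
    (i : Edge → (ℤ × ℤ) × (ℤ × ℤ)) (J : Edge → ℝ) (s : S → ℤˣ) :
    isingEnergy S E i J s = ∑ e ∈ E, J e - ∑ e ∈ E, J e * ((bond i s e : ℤ) : ℝ) := by
  rw [isingEnergy, ← Finset.sum_sub_distrib, Finset.mul_sum]
  refine Finset.sum_congr rfl fun e _ => ?_
  rw [bond]
  generalize extend S 1 s (i e).1 = u, extend S 1 s (i e).2 = v
  obtain rfl | rfl := Int.units_eq_one_or u <;> obtain rfl | rfl := Int.units_eq_one_or v <;>
    simp <;> ring

theorem exp_neg_two_mul_dualCoupling {J : Edge → ℝ} {e : Edge} (h : 0 < J e) :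
    Real.exp (-(2 * dualCoupling J e)) = Real.tanh (J e) := by
  have h₁ : 0 < Real.tanh (J e) := by
    rw [Real.tanh_eq_sinh_div_cosh]
    exact div_pos (Real.sinh_pos_iff.2 h) (Real.cosh_pos _)
  rw [dualCoupling, show -(2 * (-(1 / 2) * Real.log (Real.tanh (J e)))) =
    Real.log (Real.tanh (J e)) by ring, Real.exp_log h₁]

theorem DiscreteDomain.exp_neg_isingEnergy_dual (D : DiscreteDomain a) {J : Edge → ℝ}
    (hJ : ∀ e ∈ D.edges, 0 < J e) (t : D.faces → ℤˣ) :
    Real.exp (-isingEnergy D.faces D.edges dualEnds (dualCoupling J) t) =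
      ∏ e ∈ D.contour t, Real.tanh (J e) := by
  rw [isingEnergy_eq_sum_bond, ← Finset.sum_sub_distrib, ← Finset.sum_neg_distrib, Real.exp_sum,
    DiscreteDomain.contour, Finset.prod_filter]
  refine Finset.prod_congr rfl fun e he => ?_
  change _ = if bond dualEnds t e = -1 then _ else _
  obtain h | h := Int.units_eq_one_or (bond dualEnds t e)
  · simp [h, show (1 : ℤˣ) ≠ -1 by decide]
  · rw [if_pos h, h, ← exp_neg_two_mul_dualCoupling (hJ e he)]
    congr 1
    simp
    ring

/-- The probability of a configuration under the Ising measure. -/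
def isingProb (S : Finset (ℤ × ℤ)) (E : Finset Edge) (i : Edge → (ℤ × ℤ) × (ℤ × ℤ))
    (J : Edge → ℝ) (s : S → ℤˣ) : ℝ :=
  Real.exp (-isingEnergy S E i J s) / ∑ s' : S → ℤˣ, Real.exp (-isingEnergy S E i J s')

theorem isingProb_nonneg (S : Finset (ℤ × ℤ)) (E : Finset Edge) (i : Edge → (ℤ × ℤ) × (ℤ × ℤ))
    (J : Edge → ℝ) (s : S → ℤˣ) : 0 ≤ isingProb S E i J s :=
  div_nonneg (Real.exp_pos _).le (Finset.sum_nonneg fun _ _ => (Real.exp_pos _).le)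

theorem sum_isingProb (S : Finset (ℤ × ℤ)) (E : Finset Edge) (i : Edge → (ℤ × ℤ) × (ℤ × ℤ))
    (J : Edge → ℝ) : ∑ s, isingProb S E i J s = 1 := by
  simp only [isingProb]
  rw [← Finset.sum_div]
  exact div_self (Finset.sum_pos (fun _ _ => Real.exp_pos _) Finset.univ_nonempty).ne'

theorem DiscreteDomain.isingProb_free (D : DiscreteDomain a) (J : Edge → ℝ) (s : D.sites → ℤˣ) :
    isingProb D.sites D.edges ends J s =
      Real.exp (∑ e ∈ D.edges, J e * ((bond ends s e : ℤ) : ℝ)) / D.twistedSum 1 J := by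
  have h : ∀ s : D.sites → ℤˣ, Real.exp (-isingEnergy D.sites D.edges ends J s) =
      Real.exp (-∑ e ∈ D.edges, J e) *
        Real.exp (∑ e ∈ D.edges, J e * ((bond ends s e : ℤ) : ℝ)) := by
    intro s
    rw [isingEnergy_eq_sum_bond, ← Real.exp_add]
    congr 1
    ring
  simp only [isingProb, h]
  rw [← Finset.mul_sum, mul_div_mul_left _ _ (Real.exp_pos _).ne', DiscreteDomain.twistedSum]
  simp

/-- The correlations of the dual Ising model are ratios of twisted partition functions.  The
couplings must be positive, as the dual coupling is infinite at zero. -/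
theorem DiscreteDomain.sum_isingProb_dual (ha : 0 < a) (D : DiscreteDomain a) {J : Edge → ℝ}
    (hJ : ∀ e ∈ D.edges, 0 < J e) (B : Finset D.faces) :
    ∑ t : D.faces → ℤˣ, ((∏ z ∈ B, t z : ℤˣ) : ℤ) *
        isingProb D.faces D.edges dualEnds (dualCoupling J) t =
      D.twistedSum (gauge (B.map (Function.Embedding.subtype _))) J / D.twistedSum 1 J := by
  have h₁ : gauge ((∅ : Finset D.faces).map (Function.Embedding.subtype _)) = 1 := by
    funext e
    simp [gauge]
  have h₀ := D.twistedSum_gauge ha J ∅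
  rw [h₁] at h₀
  have hc : (∏ e ∈ D.edges, Real.cosh (J e)) * 2 ^ D.sites.card ≠ 0 :=
    mul_ne_zero (Finset.prod_pos fun e _ => Real.cosh_pos _).ne' (by positivity)
  rw [D.twistedSum_gauge ha J B, h₀, mul_div_mul_left _ _ hc, Finset.sum_div]
  refine Finset.sum_congr rfl fun t _ => ?_
  simp only [isingProb, D.exp_neg_isingEnergy_dual hJ, Finset.prod_empty, Units.val_one,
    Int.cast_one, one_mul]
  rw [mul_div_assoc]

/-! ### The killed random walk twisted by edge signs -/

section StepMatrix

open Matrix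

/-- The transition matrix of the random walk killed on leaving the domain, with entries multiplied
by the signs `η` of the edges.  At most one edge contributes to each entry. -/
def DiscreteDomain.stepMatrix (D : DiscreteDomain a) (η : Edge → ℤˣ) :
    Matrix D.sites D.sites ℝ :=
  of fun x y => ∑ e ∈ D.edges,
    if ends e = (x.1, y.1) ∨ ends e = (y.1, x.1) then ((η e : ℤ) : ℝ) / 4 else 0

theorem ends_fst_ne_snd (e : Edge) : (ends e).1 ≠ (ends e).2 := by
  obtain ⟨⟨x, y⟩, b⟩ := e
  cases b <;> simp [ends]

theorem edge_eq_of_ends {e e' : Edge} {x y : Site} (h : ends e = (x, y) ∨ ends e = (y, x))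
    (h' : ends e' = (x, y) ∨ ends e' = (y, x)) : e = e' := by
  obtain ⟨⟨x₁, y₁⟩, b⟩ := e
  obtain ⟨⟨x₂, y₂⟩, b'⟩ := e'
  obtain ⟨x₃, y₃⟩ := x
  obtain ⟨x₄, y₄⟩ := y
  cases b <;> cases b' <;> simp [ends] at h h' ⊢ <;> omega

theorem DiscreteDomain.stepMatrix_apply_of_ends (D : DiscreteDomain a) (η : Edge → ℤˣ)
    {x y : D.sites} {e : Edge} (he : e ∈ D.edges)
    (h : ends e = (x.1, y.1) ∨ ends e = (y.1, x.1)) :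
    D.stepMatrix η x y = ((η e : ℤ) : ℝ) / 4 := by
  rw [DiscreteDomain.stepMatrix, of_apply, Finset.sum_eq_single_of_mem e he, if_pos h]
  intro e' _ hne
  exact if_neg fun h' => hne (edge_eq_of_ends h' h)

theorem DiscreteDomain.stepMatrix_apply_of_not_adj (D : DiscreteDomain a) (η : Edge → ℤˣ)
    {x y : D.sites} (h : ¬ D.graph.Adj x y) : D.stepMatrix η x y = 0 :=
  Finset.sum_eq_zero fun e he => if_neg fun h' => h ⟨e, he, h'⟩

theorem DiscreteDomain.stepMatrix_isHermitian (D : DiscreteDomain a) (η : Edge → ℤˣ) :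
    (D.stepMatrix η).IsHermitian := by
  ext x y
  simp only [conjTranspose_apply, star_trivial, DiscreteDomain.stepMatrix, of_apply]
  exact Finset.sum_congr rfl fun e _ => by simp only [or_comm]

theorem DiscreteDomain.stepMatrix_neg (D : DiscreteDomain a) (η : Edge → ℤˣ) :
    D.stepMatrix (-η) = -D.stepMatrix η := by
  ext x y
  change ∑ e ∈ D.edges, _ = -∑ e ∈ D.edges, _
  rw [← Finset.sum_neg_distrib]
  refine Finset.sum_congr rfl fun e _ => ?_
  split_ifs
  · simp [neg_div]
  · simp

theorem extend_zero_eq_sum {S : Finset (ℤ × ℤ)} (φ : S → ℝ) (v : ℤ × ℤ) :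
    extend S 0 φ v = ∑ x : S, if v = x.1 then φ x else 0 := by
  by_cases h : v ∈ S
  · rw [extend_of_mem h, Finset.sum_eq_single (⟨v, h⟩ : S)]
    · simp
    · intro x _ hx
      exact if_neg fun h' => hx (Subtype.ext h'.symm)
    · simp
  · rw [extend_of_notMem h, Finset.sum_eq_zero]
    intro x _
    exact if_neg fun h' : v = x.1 => h (h' ▸ x.2)

theorem DiscreteDomain.dotProduct_stepMatrix (D : DiscreteDomain a) (η : Edge → ℤˣ)
    (φ : D.sites → ℝ) :
    φ ⬝ᵥ D.stepMatrix η *ᵥ φ = 1 / 2 * ∑ e ∈ D.edges, ((η e : ℤ) : ℝ) *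
      (extend D.sites 0 φ (ends e).1 * extend D.sites 0 φ (ends e).2) := by
  have h₁ : ∀ e : Edge, ∑ x : D.sites, ∑ y : D.sites,
      (if ends e = (x.1, y.1) ∨ ends e = (y.1, x.1) then ((η e : ℤ) : ℝ) / 4 else 0) *
        (φ x * φ y) = 1 / 2 * (((η e : ℤ) : ℝ) *
      (extend D.sites 0 φ (ends e).1 * extend D.sites 0 φ (ends e).2)) := by
    intro e
    have h₂ : ∀ x y : D.sites,
        (if ends e = (x.1, y.1) ∨ ends e = (y.1, x.1) then ((η e : ℤ) : ℝ) / 4 else 0) *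
          (φ x * φ y) = ((η e : ℤ) : ℝ) / 4 *
          ((if (ends e).1 = x.1 then φ x else 0) * (if (ends e).2 = y.1 then φ y else 0) +
            (if (ends e).2 = x.1 then φ x else 0) * (if (ends e).1 = y.1 then φ y else 0)) := by
      intro x y
      have := ends_fst_ne_snd e
      simp only [Prod.ext_iff (x := ends e)]
      split_ifs <;> first | ring1 | grind
    simp only [h₂, ← Finset.mul_sum, Finset.sum_add_distrib, ← Finset.sum_mul,
      ← extend_zero_eq_sum]
    ring
  rw [Finset.mul_sum, ← Finset.sum_congr rfl fun e _ => h₁ e, Finset.sum_comm]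
  simp only [dotProduct, mulVec, DiscreteDomain.stepMatrix, of_apply, Finset.mul_sum]
  refine Finset.sum_congr rfl fun x _ => ?_
  rw [Finset.sum_comm]
  refine Finset.sum_congr rfl fun y _ => ?_
  rw [Finset.sum_mul, Finset.mul_sum]
  exact Finset.sum_congr rfl fun e _ => by ring

theorem mem_star_iff (e : Edge) (x : Site) : e ∈ star x ↔ x = (ends e).1 ∨ x = (ends e).2 := by
  obtain ⟨⟨u, v⟩, b⟩ := e
  obtain ⟨x₁, x₂⟩ := x
  cases b <;> simp [star, ends] <;> omega

theorem card_star (x : Site) : (star x).card = 4 := by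
  obtain ⟨u, v⟩ := x
  rw [star, Finset.card_insert_of_notMem, Finset.card_insert_of_notMem,
    Finset.card_insert_of_notMem, Finset.card_singleton] <;> simp <;> omega

theorem DiscreteDomain.sum_touching (D : DiscreteDomain a) (φ : D.sites → ℝ) :
    ∑ e ∈ D.sites.biUnion star,
      (extend D.sites 0 φ (ends e).1 ^ 2 + extend D.sites 0 φ (ends e).2 ^ 2) =
        4 * (φ ⬝ᵥ φ) := by
  have h₁ : ∀ v : Site, extend D.sites 0 φ v ^ 2 =
      ∑ x : D.sites, if v = x.1 then φ x ^ 2 else 0 := by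
    intro v
    rw [← extend_zero_eq_sum fun x => φ x ^ 2]
    by_cases h : v ∈ D.sites
    · simp [extend_of_mem h]
    · simp [extend_of_notMem h]
  simp only [h₁, ← Finset.sum_add_distrib]
  rw [Finset.sum_comm, dotProduct, Finset.mul_sum]
  refine Finset.sum_congr rfl fun x _ => ?_
  have h₂ : ∀ e : Edge, ((if (ends e).1 = x.1 then φ x ^ 2 else 0) +
      if (ends e).2 = x.1 then φ x ^ 2 else 0) = if e ∈ star x.1 then φ x ^ 2 else 0 := by
    intro e
    have := ends_fst_ne_snd e
    simp only [mem_star_iff]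
    split_ifs <;> first | ring1 | grind
  have hsub : star x.1 ⊆ D.sites.biUnion star := Finset.subset_biUnion_of_mem star x.2
  simp only [h₂]
  rw [← Finset.sum_filter, Finset.filter_mem_eq_inter, Finset.inter_eq_right.2 hsub,
    Finset.sum_const, card_star]
  simp
  ring

theorem DiscreteDomain.edges_subset_touching (D : DiscreteDomain a) :
    D.edges ⊆ D.sites.biUnion star := fun e he =>
  Finset.mem_biUnion.2 ⟨_, (D.ends_mem_sites he).1, (mem_star_iff e _).2 (Or.inl rfl)⟩

/-- The quadratic form of the Gaussian free field twisted by the signs `η`.  Every site contributes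
`4 φ ^ 2`, one square for each of the four lattice edges that contain it. -/
def DiscreteDomain.twistedEnergy (D : DiscreteDomain a) (η : Edge → ℤˣ) (φ : D.sites → ℝ) : ℝ :=
  1 / 2 * (φ ⬝ᵥ ((4 : ℝ) • (1 - D.stepMatrix η)) *ᵥ φ)

theorem DiscreteDomain.twistedEnergy_eq (D : DiscreteDomain a) (η : Edge → ℤˣ)
    (φ : D.sites → ℝ) :
    D.twistedEnergy η φ = 2 * (φ ⬝ᵥ φ) - ∑ e ∈ D.edges, ((η e : ℤ) : ℝ) *
      (extend D.sites 0 φ (ends e).1 * extend D.sites 0 φ (ends e).2) := by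
  rw [DiscreteDomain.twistedEnergy, smul_mulVec, dotProduct_smul, sub_mulVec, one_mulVec,
    dotProduct_sub, D.dotProduct_stepMatrix, smul_eq_mul]
  ring

theorem DiscreteDomain.twistedEnergy_eq_sum_sq (D : DiscreteDomain a) (η : Edge → ℤˣ)
    (φ : D.sites → ℝ) :
    D.twistedEnergy η φ = 1 / 2 * ∑ e ∈ D.sites.biUnion star,
      if e ∈ D.edges then
        (extend D.sites 0 φ (ends e).1 - ((η e : ℤ) : ℝ) * extend D.sites 0 φ (ends e).2) ^ 2
      else extend D.sites 0 φ (ends e).1 ^ 2 + extend D.sites 0 φ (ends e).2 ^ 2 := by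
  have h : ∀ e : Edge, (if e ∈ D.edges then
        (extend D.sites 0 φ (ends e).1 - ((η e : ℤ) : ℝ) * extend D.sites 0 φ (ends e).2) ^ 2
      else extend D.sites 0 φ (ends e).1 ^ 2 + extend D.sites 0 φ (ends e).2 ^ 2) =
      (extend D.sites 0 φ (ends e).1 ^ 2 + extend D.sites 0 φ (ends e).2 ^ 2) -
        if e ∈ D.edges then 2 * (((η e : ℤ) : ℝ) *
          (extend D.sites 0 φ (ends e).1 * extend D.sites 0 φ (ends e).2)) else 0 := by
    intro e
    split_ifs
    · obtain hη | hη := Int.units_eq_one_or (η e) <;> simp [hη] <;> ring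
    · ring
  simp only [h, Finset.sum_sub_distrib, D.sum_touching]
  rw [← Finset.sum_filter, Finset.filter_mem_eq_inter,
    Finset.inter_eq_right.2 D.edges_subset_touching, ← Finset.mul_sum, D.twistedEnergy_eq]
  ring

theorem DiscreteDomain.energy_eq_twistedEnergy (D : DiscreteDomain a) (φ : D.sites → ℝ) :
    D.energy φ = D.twistedEnergy 1 φ := by
  simp [D.twistedEnergy_eq_sum_sq, DiscreteDomain.energy]

/-- The twisted energy is positive: if it vanishes then the field has constant modulus along the
rows of the domain, and vanishes where they leave it. -/
theorem DiscreteDomain.twistedEnergy_pos (D : DiscreteDomain a) (η : Edge → ℤˣ)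
    {φ : D.sites → ℝ} (hφ : φ ≠ 0) : 0 < D.twistedEnergy η φ := by
  have hnonneg : ∀ e ∈ D.sites.biUnion star, 0 ≤ if e ∈ D.edges then
        (extend D.sites 0 φ (ends e).1 - ((η e : ℤ) : ℝ) * extend D.sites 0 φ (ends e).2) ^ 2
      else extend D.sites 0 φ (ends e).1 ^ 2 + extend D.sites 0 φ (ends e).2 ^ 2 := by
    intro e _
    split_ifs <;> positivity
  rw [D.twistedEnergy_eq_sum_sq]
  refine mul_pos (by norm_num) (lt_of_le_of_ne (Finset.sum_nonneg hnonneg) fun h0 => hφ ?_)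
  have h := (Finset.sum_eq_zero_iff_of_nonneg hnonneg).1 h0.symm
  have hmem : ∀ v : Site, extend D.sites 0 φ v ≠ 0 → v ∈ D.sites := by
    intro v hv
    by_contra hv'
    exact hv (extend_of_notMem hv')
  have hstep : ∀ x y : ℤ, extend D.sites 0 φ (x, y) ≠ 0 → extend D.sites 0 φ (x - 1, y) ≠ 0 := by
    intro x y hxy hxy'
    have he := h ((x - 1, y), true) (Finset.mem_biUnion.2 ⟨_, hmem _ hxy, by
      rw [mem_star_iff]
      simp [ends]⟩)
    simp only [ends, if_true, sub_add_cancel, hxy'] at he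
    split_ifs at he
    · obtain hη | hη := Int.units_eq_one_or (η ((x - 1, y), true)) <;> simp [hη] at he <;>
        exact hxy he
    · simp at he
      exact hxy he
  funext ⟨⟨x, y⟩, hx⟩
  by_contra hne
  have hall : ∀ n : ℕ, extend D.sites 0 φ (x - n, y) ≠ 0 := by
    intro n
    induction n with
    | zero =>
      rw [Nat.cast_zero, sub_zero, extend_of_mem hx]
      exact hne
    | succ n ih =>
      rw [Nat.cast_succ, sub_add_eq_sub_sub]
      exact hstep _ _ ih
  have hinj : Function.Injective fun n : ℕ => (x - n, y) := fun m n hmn => by simpa using hmn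
  exact Set.infinite_of_injective_forall_mem hinj (s := (D.sites : Set Site))
    (fun n => hmem _ (hall n)) D.sites.finite_toSet

theorem DiscreteDomain.posDef_one_sub_stepMatrix (D : DiscreteDomain a) (η : Edge → ℤˣ) :
    (1 - D.stepMatrix η).PosDef := by
  refine PosDef.of_dotProduct_mulVec_pos (isHermitian_one.sub (D.stepMatrix_isHermitian η))
    fun {φ} hφ => ?_
  have h := D.twistedEnergy_pos η hφ
  rw [DiscreteDomain.twistedEnergy, smul_mulVec, dotProduct_smul, smul_eq_mul] at h
  rw [star_trivial]
  linarith

theorem DiscreteDomain.posDef_one_add_stepMatrix (D : DiscreteDomain a) (η : Edge → ℤˣ) :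
    (1 + D.stepMatrix η).PosDef := by
  have h := D.posDef_one_sub_stepMatrix (-η)
  rwa [D.stepMatrix_neg, sub_neg_eq_add] at h

end StepMatrix

/-! ### Sums over loops -/

section Walks

open SimpleGraph

variable {V : Type*}

/-- The product of the entries of a matrix along the steps of a walk. -/
def walkWeight {G : SimpleGraph V} (M : Matrix V V ℝ) {u v : V} (p : G.Walk u v) : ℝ :=
  (p.darts.map fun d => M d.fst d.snd).prod

theorem walkWeight_cons {G : SimpleGraph V} (M : Matrix V V ℝ) {u v w : V} (h : G.Adj u v)
    (p : G.Walk v w) : walkWeight M (Walk.cons h p) = M u v * walkWeight M p := by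
  simp [walkWeight]

/-- Entries of matrix powers are sums over walks. -/
theorem sum_walkWeight [Fintype V] [DecidableEq V] (G : SimpleGraph V) [G.LocallyFinite]
    (M : Matrix V V ℝ) (hM : ∀ u v, ¬ G.Adj u v → M u v = 0) (n : ℕ) (u v : V) :
    ∑ p ∈ G.finsetWalkLength n u v, walkWeight M p = (M ^ n) u v := by
  induction n generalizing u with
  | zero =>
    obtain rfl | h := eq_or_ne u v
    · simp [finsetWalkLength, walkWeight]
    · simp [finsetWalkLength, h]
  | succ n ih =>
    rw [pow_succ', Matrix.mul_apply, finsetWalkLength, Finset.sum_biUnion]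
    · have h : ∀ w : G.neighborSet u, ∑ p ∈ G.finsetWalkLength n w v,
          walkWeight M (Walk.cons w.2 p) = M u w * (M ^ n) w v := by
        intro w
        rw [← ih, Finset.mul_sum]
        exact Finset.sum_congr rfl fun p _ => walkWeight_cons M w.2 p
      calc _ = ∑ w : G.neighborSet u, M u w * (M ^ n) w v :=
          Finset.sum_congr rfl fun w _ => (Finset.sum_map _ _ _).trans (h w)
        _ = ∑ w ∈ (G.neighborSet u).toFinset, M u w * (M ^ n) w v :=
          Finset.sum_set_coe (f := fun w => M u w * (M ^ n) w v) _
        _ = _ := Finset.sum_subset (Finset.subset_univ _) fun w _ hw => by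
          rw [hM u w (by simpa using hw), zero_mul]
    · rintro ⟨x, hx⟩ - ⟨y, hy⟩ - hxy
      rw [Function.onFun, Finset.disjoint_left]
      intro p hp hp'
      simp only [Finset.mem_map] at hp hp'
      obtain ⟨px, _, rfl⟩ := hp
      obtain ⟨py, hpy, hp⟩ := hp'
      cases hp
      simp at hxy

end Walks

/-- The holonomy of a loop: the product of the signs of the edges that it traverses. -/
def loopSign {D : DiscreteDomain a} (η : Edge → ℤˣ) (γ : Loop D) : ℤˣ :=
  (γ.2.1.darts.map fun d => η (D.dartEdge d)).prod

theorem prod_stepMatrix_darts {D : DiscreteDomain a} (η : Edge → ℤˣ) (l : List D.graph.Dart) :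
    (l.map fun d => D.stepMatrix η d.fst d.snd).prod =
      4⁻¹ ^ l.length * (((l.map fun d => η (D.dartEdge d)).prod : ℤ) : ℝ) := by
  induction l with
  | nil => simp
  | cons d l ih =>
    obtain ⟨h₁, h₂⟩ := D.dartEdge_spec d
    rw [List.map_cons, List.prod_cons, ih, D.stepMatrix_apply_of_ends η h₁ h₂, List.map_cons,
      List.prod_cons, List.length_cons, Units.val_mul]
    push_cast
    ring

theorem loopMass_mul_loopSign {D : DiscreteDomain a} (η : Edge → ℤˣ) (γ : Loop D) :
    (loopMass γ : ℝ) * ((loopSign η γ : ℤ) : ℝ) =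
      walkWeight (D.stepMatrix η) γ.2.1 / γ.2.1.length := by
  rw [walkWeight, prod_stepMatrix_darts, SimpleGraph.Walk.length_darts, loopMass, loopSign]
  push_cast
  ring

/-- Loops sorted by their length. -/
def loopEquiv (D : DiscreteDomain a) :
    (Σ k : ℕ, Σ x : D.sites, {p : D.graph.Walk x x // p.length = k + 1}) ≃ Loop D where
  toFun q := ⟨q.2.1, ⟨q.2.2.1, by rw [q.2.2.2]; omega⟩⟩
  invFun γ := ⟨γ.2.1.length - 1, γ.1, ⟨γ.2.1, by have := γ.2.2; omega⟩⟩
  left_inv := by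
    rintro ⟨k, x, ⟨p, hp⟩⟩
    obtain rfl : k = p.length - 1 := by omega
    rfl
  right_inv _ := rfl

theorem loopMass_mul_loopSign_loopEquiv (D : DiscreteDomain a) (η : Edge → ℤˣ) (k : ℕ)
    (q : Σ x : D.sites, {p : D.graph.Walk x x // p.length = k + 1}) :
    (loopMass (loopEquiv D ⟨k, q⟩) : ℝ) * ((loopSign η (loopEquiv D ⟨k, q⟩) : ℤ) : ℝ) =
      walkWeight (D.stepMatrix η) q.2.1 / (k + 1) := by
  rw [loopMass_mul_loopSign, ← Nat.cast_succ]
  exact congrArg (fun n : ℕ => walkWeight (D.stepMatrix η) q.2.1 / (n : ℝ)) q.2.2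

theorem hasSum_loops_of_length (D : DiscreteDomain a) (η : Edge → ℤˣ) (k : ℕ) :
    HasSum (fun q : Σ x : D.sites, {p : D.graph.Walk x x // p.length = k + 1} =>
      (loopMass (loopEquiv D ⟨k, q⟩) : ℝ) * ((loopSign η (loopEquiv D ⟨k, q⟩) : ℤ) : ℝ))
      ((D.stepMatrix η ^ (k + 1)).trace / (k + 1)) := by
  classical
  simp only [loopMass_mul_loopSign_loopEquiv]
  refine HasSum.div_const ?_ _
  have h : (D.stepMatrix η ^ (k + 1)).trace =
      ∑ q : Σ x : D.sites, {p : D.graph.Walk x x // p.length = k + 1},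
        walkWeight (D.stepMatrix η) q.2.1 := by
    rw [Fintype.sum_sigma, Matrix.trace]
    refine Finset.sum_congr rfl fun x _ => ?_
    rw [Matrix.diag_apply,
      ← sum_walkWeight D.graph _ fun u v => D.stepMatrix_apply_of_not_adj η]
    exact Finset.sum_subtype _ (fun p => SimpleGraph.mem_finsetWalkLength_iff) _
  rw [h]
  exact hasSum_fintype _

/-- Fibrewise summation of a family that is absolutely summable because the sums of its absolute
values over the fibres are summable. -/
theorem hasSum_of_sigma_of_abs_eq {κ : Type*} {τ : κ → Type*} {f g : (Σ k, τ k) → ℝ}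
    (hfg : ∀ q, |f q| = g q) {F G : κ → ℝ} {c d : ℝ} (hF : ∀ k, HasSum (fun q => f ⟨k, q⟩) (F k))
    (hG : ∀ k, HasSum (fun q => g ⟨k, q⟩) (G k)) (hFc : HasSum F c) (hGd : HasSum G d) :
    HasSum f c := by
  have hg0 : ∀ q, 0 ≤ g q := fun q => (hfg q) ▸ abs_nonneg _
  have hg : Summable g := by
    refine (summable_sigma_of_nonneg hg0).2 ⟨fun k => (hG k).summable, ?_⟩
    simpa only [(hG _).tsum_eq] using hGd.summable
  have hf : Summable f := Summable.of_abs (by simpa only [hfg] using hg)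
  have h := hf.hasSum.sigma hF
  exact h.unique hFc ▸ hf.hasSum

/-- The total mass of the loop measure, weighted by the holonomies of the loops. -/
theorem hasSum_loopMass_mul_loopSign (D : DiscreteDomain a) (η : Edge → ℤˣ) :
    HasSum (fun γ : Loop D => (loopMass γ : ℝ) * ((loopSign η γ : ℤ) : ℝ))
      (-Real.log (1 - D.stepMatrix η).det) := by
  have hdet : ∀ η : Edge → ℤˣ, HasSum
      (fun k : ℕ => (D.stepMatrix η ^ (k + 1)).trace / (k + 1))
        (-Real.log (1 - D.stepMatrix η).det) := fun η =>
    hasSum_trace_pow_div (D.stepMatrix_isHermitian η) (D.posDef_one_sub_stepMatrix η)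
      (D.posDef_one_add_stepMatrix η)
  rw [← (loopEquiv D).hasSum_iff]
  refine hasSum_of_sigma_of_abs_eq
    (g := fun q => (loopMass (loopEquiv D q) : ℝ) * ((loopSign 1 (loopEquiv D q) : ℤ) : ℝ))
    (fun q => ?_) (hasSum_loops_of_length D η) (hasSum_loops_of_length D 1) (hdet η) (hdet 1)
  have h : loopSign 1 (loopEquiv D q) = 1 := by simp [loopSign]
  rw [h, Function.comp_apply, abs_mul]
  obtain h' | h' := Int.units_eq_one_or (loopSign η (loopEquiv D q)) <;> simp [h']

theorem summable_loopMass (D : DiscreteDomain a) : Summable fun γ : Loop D => loopMass γ := by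
  have h := (hasSum_loopMass_mul_loopSign D 1).summable
  rw [← NNReal.summable_coe]
  refine h.congr fun γ => ?_
  simp [loopSign]

instance (D : DiscreteDomain a) : Countable (Loop D) := by
  classical
  exact (loopEquiv D).countable_iff.1 inferInstance

/-! ### The law of the spin field -/

section Spins

instance : MeasurableSingletonClass ℤˣ where
  measurableSet_singleton u :=
    ⟨{(u : ℤ)}, MeasurableSet.of_discrete, by ext v; simp [Units.ext_iff]⟩

/-- The law of finitely many spins is determined by the expectations of their products. -/
theorem ext_of_sum_prod_spins {ι : Type*} [Fintype ι] [DecidableEq ι]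
    {μ ν : Measure (ι → ℤˣ)} [IsFiniteMeasure μ] [IsFiniteMeasure ν]
    (h : ∀ B : Finset ι, ∑ t : ι → ℤˣ, (((∏ z ∈ B, t z : ℤˣ) : ℤ) : ℝ) * μ.real {t} =
      ∑ t : ι → ℤˣ, (((∏ z ∈ B, t z : ℤˣ) : ℤ) : ℝ) * ν.real {t}) : μ = ν := by
  have horth : ∀ t₀ t : ι → ℤˣ, ∑ B : Finset ι, (((∏ z ∈ B, t₀ z : ℤˣ) : ℤ) : ℝ) *
      (((∏ z ∈ B, t z : ℤˣ) : ℤ) : ℝ) = if t = t₀ then 2 ^ Fintype.card ι else 0 := by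
    intro t₀ t
    have h₁ : ∀ B : Finset ι, (((∏ z ∈ B, t₀ z : ℤˣ) : ℤ) : ℝ) *
        (((∏ z ∈ B, t z : ℤˣ) : ℤ) : ℝ) = ∏ z ∈ B, (((t₀ z * t z : ℤˣ) : ℤ) : ℝ) := by
      intro B
      push_cast [Units.coe_prod]
      rw [Finset.prod_mul_distrib]
    simp only [h₁]
    rw [← Finset.powerset_univ, ← Finset.prod_one_add]
    split_ifs with ht
    · have h₂ : ∀ z, t₀ z * t z = 1 := fun z => by rw [ht, ← sq, Int.units_sq]
      simp only [h₂]
      norm_num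
    · obtain ⟨z, hz⟩ := Function.ne_iff.1 ht
      refine Finset.prod_eq_zero (Finset.mem_univ z) ?_
      have h₂ : t₀ z * t z = -1 := by
        generalize t₀ z = u, t z = v at *
        revert u v
        decide
      rw [h₂]
      norm_num
  have hinv : ∀ (κ : Measure (ι → ℤˣ)) (t₀ : ι → ℤˣ),
      ∑ B : Finset ι, (((∏ z ∈ B, t₀ z : ℤˣ) : ℤ) : ℝ) *
        ∑ t : ι → ℤˣ, (((∏ z ∈ B, t z : ℤˣ) : ℤ) : ℝ) * κ.real {t} =
          2 ^ Fintype.card ι * κ.real {t₀} := by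
    intro κ t₀
    simp only [Finset.mul_sum, ← mul_assoc]
    rw [Finset.sum_comm]
    simp only [← Finset.sum_mul, horth, ite_mul, zero_mul]
    simp
  refine ext_iff_measureReal_singleton.2 fun t₀ => ?_
  have h₁ := hinv μ t₀
  simp only [h, hinv ν t₀] at h₁
  exact (mul_left_cancel₀ (by positivity) h₁).symm

theorem negOnePow_natCast_mul (n : ℕ) (w : ℤ) : ((n : ℤ) * w).negOnePow = w.negOnePow ^ n := by
  rw [Int.negOnePow_def, Int.negOnePow_def, mul_comm, zpow_mul, zpow_natCast]

theorem totalWinding_eq_sum {D : DiscreteDomain a} {L : Loop D → ℕ} {S : Finset (Loop D)}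
    (hS : ∀ γ, L γ ≠ 0 → γ ∈ S) (z : Face) :
    totalWinding L z = ∑ γ ∈ S, (L γ : ℤ) * windingNumber γ.2.1 (centre a z) := by
  refine finsum_eq_sum_of_support_subset _ fun γ hγ => hS γ ?_
  rintro h0
  simp [h0] at hγ

theorem loopSign_gauge (ha : 0 < a) {D : DiscreteDomain a} (B : Finset Face) (γ : Loop D) :
    loopSign (gauge B) γ = ∏ z ∈ B, (windingNumber γ.2.1 (centre a z)).negOnePow := by
  simp only [negOnePow_windingNumber ha, loopSign, gauge]
  induction γ.2.1.darts with
  | nil => simp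
  | cons d l ih => simp [ih, Finset.prod_mul_distrib]

/-- The product of the spins in a set of faces is the product of the holonomies of all loops of
the soup. -/
theorem prod_spinField (ha : 0 < a) {D : DiscreteDomain a} {L : Loop D → ℕ}
    (hL : {γ | L γ ≠ 0}.Finite) (B : Finset D.faces) :
    (((∏ z ∈ B, spinField D L z : ℤˣ) : ℤ) : ℝ) =
      ∏ᶠ γ, ((loopSign (gauge (B.map (Function.Embedding.subtype _))) γ : ℤ) : ℝ) ^ L γ := by
  set η := gauge (B.map (Function.Embedding.subtype _)) with hη
  have hS : ∀ γ, L γ ≠ 0 → γ ∈ hL.toFinset := fun γ hγ => by simpa using hγ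
  have h₁ : ∏ z ∈ B, spinField D L z = ∏ γ ∈ hL.toFinset, loopSign η γ ^ L γ := by
    have hsum : ∀ (S : Finset (Loop D)) (f : Loop D → ℤ),
        (∑ γ ∈ S, f γ).negOnePow = ∏ γ ∈ S, (f γ).negOnePow := by
      classical
      intro S f
      induction S using Finset.induction_on with
      | empty => simp
      | insert γ S hγ ih => rw [Finset.sum_insert hγ, Finset.prod_insert hγ, Int.negOnePow_add, ih]
    simp only [spinField, totalWinding_eq_sum hS, hsum, negOnePow_natCast_mul]
    rw [Finset.prod_comm]
    refine Finset.prod_congr rfl fun γ _ => ?_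
    rw [hη, loopSign_gauge ha, Finset.prod_map, Finset.prod_pow]
    rfl
  rw [h₁, finprod_eq_prod_of_mulSupport_subset (s := hL.toFinset)]
  · push_cast [Units.coe_prod]
    rfl
  · intro γ hγ
    refine hS γ ?_
    rintro h0
    simp [h0] at hγ

instance (D : DiscreteDomain a) (l : ℝ≥0) : IsProbabilityMeasure (loopSoup D l) := by
  unfold loopSoup
  infer_instance

theorem ae_finite_loopSoup (D : DiscreteDomain a) (l : ℝ≥0) :
    ∀ᵐ L ∂(loopSoup D l), {γ : Loop D | L γ ≠ 0}.Finite :=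
  ae_finite_infinitePi_poissonMeasure ((summable_loopMass D).mul_left l)

/-- Almost surely the total winding is the limit of its finite partial sums, so that it is
measurable up to a null set. -/
theorem aemeasurable_spinField (D : DiscreteDomain a) (l : ℝ≥0) :
    AEMeasurable (spinField D) (loopSoup D l) := by
  refine aemeasurable_pi_iff.2 fun z => ?_
  refine (Measurable.of_discrete (f := Int.negOnePow)).comp_aemeasurable
    (f := fun L => totalWinding L z.1) ?_
  refine aemeasurable_of_tendsto_metrizable_ae (Filter.atTop : Filter (Finset (Loop D)))
    (f := fun S L => ∑ γ ∈ S, (L γ : ℤ) * windingNumber γ.2.1 (centre a z)) (fun S => ?_) ?_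
  · refine Measurable.aemeasurable (Finset.measurable_sum _ fun γ _ => ?_)
    exact (Measurable.of_discrete
      (f := fun n : ℕ => (n : ℤ) * windingNumber γ.2.1 (centre a z))).comp (measurable_pi_apply γ)
  · filter_upwards [ae_finite_loopSoup D l] with L hL
    refine tendsto_const_nhds.congr' ?_
    filter_upwards [Filter.eventually_ge_atTop hL.toFinset] with S hS
    exact totalWinding_eq_sum (fun γ hγ => hS (by simpa using hγ)) z

/-- The correlations of the spin field of the loop soup with intensity `1/2` are ratios of the
square roots of determinants. -/
theorem sum_prod_spins_loopSoup (ha : 0 < a) (D : DiscreteDomain a) (B : Finset D.faces) :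
    ∑ t : D.faces → ℤˣ, (((∏ z ∈ B, t z : ℤˣ) : ℤ) : ℝ) *
        ((loopSoup D (1 / 2)).map (spinField D)).real {t} =
      √(1 - D.stepMatrix 1).det /
        √(1 - D.stepMatrix (gauge (B.map (Function.Embedding.subtype _)))).det := by
  set η := gauge (B.map (Function.Embedding.subtype _)) with hη
  have : IsProbabilityMeasure ((loopSoup D (1 / 2)).map (spinField D)) :=
    Measure.isProbabilityMeasure_map (aemeasurable_spinField D _)
  have h₁ := integral_fintype (μ := (loopSoup D (1 / 2)).map (spinField D))
    (f := fun t : D.faces → ℤˣ => (((∏ z ∈ B, t z : ℤˣ) : ℤ) : ℝ)) (Integrable.of_finite)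
  rw [integral_map (aemeasurable_spinField D _) (Measurable.of_discrete.aestronglyMeasurable)] at h₁
  have h₂ : ∫ L, (((∏ z ∈ B, spinField D L z : ℤˣ) : ℤ) : ℝ) ∂(loopSoup D (1 / 2)) =
      ∫ L, ∏ᶠ γ, ((loopSign η γ : ℤ) : ℝ) ^ L γ ∂(loopSoup D (1 / 2)) := by
    refine integral_congr_ae ?_
    filter_upwards [ae_finite_loopSoup D (1 / 2)] with L hL
    exact prod_spinField ha hL B
  rw [h₂, loopSoup, integral_finprod_pow_infinitePi ((summable_loopMass D).mul_left (1 / 2))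
    (fun γ => ((loopSign η γ : ℤ) : ℝ)) (fun γ => by
      obtain h | h := Int.units_eq_one_or (loopSign η γ) <;> simp [h])] at h₁
  have h₃ : ∑' γ : Loop D, (((1 / 2 : ℝ≥0) * loopMass γ : ℝ≥0) : ℝ) *
      (((loopSign η γ : ℤ) : ℝ) - 1) =
        1 / 2 * (-Real.log (1 - D.stepMatrix η).det - -Real.log (1 - D.stepMatrix 1).det) := by
    have h := ((hasSum_loopMass_mul_loopSign D η).sub (hasSum_loopMass_mul_loopSign D 1)).mul_left
      (1 / 2 : ℝ)
    rw [← h.tsum_eq]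
    refine tsum_congr fun γ => ?_
    have h1 : loopSign 1 γ = 1 := by simp [loopSign]
    rw [h1]
    push_cast
    ring
  have hd₁ := (D.posDef_one_sub_stepMatrix 1).det_pos
  have hd₂ := (D.posDef_one_sub_stepMatrix η).det_pos
  rw [h₃, show (1 / 2 : ℝ) * (-Real.log (1 - D.stepMatrix η).det -
      -Real.log (1 - D.stepMatrix 1).det) = Real.log (1 - D.stepMatrix 1).det / 2 -
        Real.log (1 - D.stepMatrix η).det / 2 by ring, Real.exp_sub, ← Real.log_sqrt hd₁.le,
    ← Real.log_sqrt hd₂.le, Real.exp_log (Real.sqrt_pos.2 hd₁),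
    Real.exp_log (Real.sqrt_pos.2 hd₂)] at h₁
  rw [h₁]
  refine Finset.sum_congr rfl fun t _ => ?_
  rw [smul_eq_mul, mul_comm]
  rfl

end Spins

/-! ### Resampling the signs of the Gaussian free field -/

section SignFlips

variable {S : Finset Site}

/-- The field with signs `s` and amplitude `r`. -/
def signMul (s : S → ℤˣ) (r : S → ℝ) : S → ℝ := fun x => ((s x : ℤ) : ℝ) * r x

theorem measurable_amplitude : Measurable (amplitude (S := S)) :=
  measurable_pi_lambda _ fun x => (measurable_pi_apply x).abs

theorem measurable_fieldSign : Measurable (fieldSign (S := S)) :=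
  measurable_pi_lambda _ fun x => Measurable.ite
    (measurableSet_le measurable_const (measurable_pi_apply x)) measurable_const measurable_const

theorem measurable_signMul (s : S → ℤˣ) : Measurable (signMul s) :=
  measurable_pi_lambda _ fun x => (measurable_pi_apply x).const_mul _

theorem measurePreserving_signMul (s : S → ℤˣ) :
    MeasurePreserving (signMul s) (volume : Measure (S → ℝ)) volume := by
  refine volume_preserving_pi (f := fun x : S => fun t : ℝ => ((s x : ℤ) : ℝ) * t) fun x => ?_
  obtain h | h := Int.units_eq_one_or (s x)
  · simp only [h, Units.val_one, Int.cast_one, one_mul]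
    exact MeasurePreserving.id _
  · simp only [h, Units.val_neg, Units.val_one, Int.cast_neg, Int.cast_one, neg_mul, one_mul]
    exact Measure.measurePreserving_neg _

theorem fieldSign_mul_amplitude (φ : S → ℝ) : signMul (fieldSign φ) (amplitude φ) = φ := by
  funext x
  simp only [signMul, fieldSign, amplitude]
  split_ifs with h
  · simp [abs_of_nonneg h]
  · simp [abs_of_neg (not_le.1 h)]

theorem signMul_mul (s s' : S → ℤˣ) (r : S → ℝ) :
    signMul (s * s') r = signMul s (signMul s' r) := by
  funext x
  simp [signMul, mul_assoc]

theorem amplitude_signMul (s : S → ℤˣ) (φ : S → ℝ) :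
    amplitude (signMul s (amplitude φ)) = amplitude φ := by
  funext x
  obtain h | h := Int.units_eq_one_or (s x) <;> simp [signMul, amplitude, h]

theorem fieldSign_signMul (s : S → ℤˣ) {φ : S → ℝ} (hφ : ∀ x, φ x ≠ 0) :
    fieldSign (signMul s (amplitude φ)) = s := by
  funext x
  have hx : 0 < |φ x| := abs_pos.2 (hφ x)
  obtain h | h := Int.units_eq_one_or (s x)
  · simp [signMul, amplitude, fieldSign, h]
  · simp [signMul, amplitude, fieldSign, h, hφ x]

theorem ae_ne_zero : ∀ᵐ φ : S → ℝ, ∀ x, φ x ≠ 0 :=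
  ae_all_iff.2 fun x => Measure.ae_eval_ne (fun _ : S => (volume : Measure ℝ)) x 0

/-- Lebesgue measure is invariant under independent resampling of the signs of the coordinates. -/
theorem lintegral_signMul {G : (S → ℝ) → ℝ≥0∞} (hG : Measurable G) :
    2 ^ S.card * ∫⁻ φ, G φ = ∫⁻ φ, ∑ s : S → ℤˣ, G (signMul s (amplitude φ)) := by
  have h₁ : ∀ φ : S → ℝ, ∑ s : S → ℤˣ, G (signMul s (amplitude φ)) =
      ∑ s : S → ℤˣ, G (signMul s φ) := by
    intro φ
    rw [← Equiv.sum_comp (Equiv.mulRight (fieldSign φ))]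
    refine Finset.sum_congr rfl fun s _ => ?_
    rw [Equiv.coe_mulRight, signMul_mul, fieldSign_mul_amplitude]
  simp only [h₁]
  rw [lintegral_finsetSum _ fun s _ =>
    show Measurable fun φ => G (signMul s φ) from hG.comp (measurable_signMul s)]
  simp only [(measurePreserving_signMul _).lintegral_comp hG]
  rw [Finset.sum_const, Finset.card_univ, card_spins, nsmul_eq_mul]
  push_cast
  rfl

end SignFlips

/-- The unnormalised density of the Gaussian free field twisted by the signs `η`. -/
def DiscreteDomain.weight (D : DiscreteDomain a) (η : Edge → ℤˣ) (φ : D.sites → ℝ) : ℝ≥0∞ :=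
  ENNReal.ofReal (Real.exp (-D.twistedEnergy η φ))

theorem measurable_extend {S : Finset (ℤ × ℤ)} (v : ℤ × ℤ) :
    Measurable fun φ : S → ℝ => extend S 0 φ v := by
  by_cases h : v ∈ S
  · simp only [extend_of_mem h]
    fun_prop
  · simp only [extend_of_notMem h]
    fun_prop

theorem DiscreteDomain.measurable_weight (D : DiscreteDomain a) (η : Edge → ℤˣ) :
    Measurable (D.weight η) := by
  unfold DiscreteDomain.weight
  simp only [D.twistedEnergy_eq, dotProduct]
  have := fun v => measurable_extend (S := D.sites) v
  fun_prop

/-- The partition functions of the twisted fields are `det ^ (-1 / 2)` up to a common factor. -/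
theorem DiscreteDomain.lintegral_weight (D : DiscreteDomain a) :
    ∃ c : ℝ≥0∞, c ≠ 0 ∧ c ≠ ∞ ∧ ∀ η : Edge → ℤˣ,
      ∫⁻ φ, D.weight η φ = ENNReal.ofReal (√(1 - D.stepMatrix η).det)⁻¹ * c := by
  have h4 : (0 : ℝ) < 4 ^ Fintype.card D.sites := by positivity
  refine ⟨ENNReal.ofReal (√(4 ^ Fintype.card D.sites))⁻¹ *
    ∫⁻ φ : D.sites → ℝ, ENNReal.ofReal (Real.exp (-(1 / 2 * (φ ⬝ᵥ φ)))), ?_, ?_, fun η => ?_⟩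
  · refine mul_ne_zero ?_ lintegral_exp_neg_sq_ne_zero
    simp
  · exact ENNReal.mul_ne_top ENNReal.ofReal_ne_top lintegral_exp_neg_sq_ne_top
  · have h := lintegral_exp_neg_quadratic
      ((D.posDef_one_sub_stepMatrix η).smul (show (0 : ℝ) < 4 by norm_num))
    rw [Matrix.det_smul, Real.sqrt_mul h4.le, mul_inv, mul_comm (√(4 ^ _))⁻¹,
      ENNReal.ofReal_mul (by positivity), mul_assoc] at h
    exact h

theorem DiscreteDomain.lintegral_weight_ne_zero (D : DiscreteDomain a) (η : Edge → ℤˣ) :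
    ∫⁻ φ, D.weight η φ ≠ 0 := by
  obtain ⟨c, h0, -, h⟩ := D.lintegral_weight
  rw [h]
  refine mul_ne_zero ?_ h0
  simpa using (D.posDef_one_sub_stepMatrix η).det_pos

theorem DiscreteDomain.lintegral_weight_ne_top (D : DiscreteDomain a) (η : Edge → ℤˣ) :
    ∫⁻ φ, D.weight η φ ≠ ∞ := by
  obtain ⟨c, -, hc, h⟩ := D.lintegral_weight
  rw [h]
  exact ENNReal.mul_ne_top ENNReal.ofReal_ne_top hc

theorem DiscreteDomain.dgff_eq (D : DiscreteDomain a) :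
    D.dgff = (∫⁻ φ, D.weight 1 φ)⁻¹ • (volume.withDensity (D.weight 1)) := by
  simp only [DiscreteDomain.dgff, D.energy_eq_twistedEnergy]
  rfl

theorem DiscreteDomain.lintegral_dgff (D : DiscreteDomain a) {f : (D.sites → ℝ) → ℝ≥0∞}
    (hf : Measurable f) :
    ∫⁻ φ, f φ ∂D.dgff = (∫⁻ φ, D.weight 1 φ)⁻¹ * ∫⁻ φ, D.weight 1 φ * f φ := by
  rw [D.dgff_eq, lintegral_smul_measure,
    lintegral_withDensity_eq_lintegral_mul _ (D.measurable_weight 1) hf, smul_eq_mul]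
  rfl

instance (D : DiscreteDomain a) : IsProbabilityMeasure D.dgff where
  measure_univ := by
    rw [← lintegral_one, D.lintegral_dgff measurable_const]
    simp only [mul_one]
    exact ENNReal.inv_mul_cancel (D.lintegral_weight_ne_zero 1) (D.lintegral_weight_ne_top 1)

theorem DiscreteDomain.dgff_absolutelyContinuous (D : DiscreteDomain a) : D.dgff ≪ volume := by
  rw [D.dgff_eq]
  exact Measure.smul_absolutelyContinuous.trans (withDensity_absolutelyContinuous _ _)

theorem extend_signMul {S : Finset Site} (s : S → ℤˣ) (r : S → ℝ) (v : Site) :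
    extend S 0 (signMul s r) v = (((extend S 1 s v : ℤˣ) : ℤ) : ℝ) * extend S 0 r v := by
  by_cases h : v ∈ S
  · simp only [extend_of_mem h, signMul]
  · simp only [extend_of_notMem h, mul_zero]

/-- Given its amplitude, the sign of a twisted field is a twisted Ising model. -/
theorem DiscreteDomain.weight_signMul (D : DiscreteDomain a) (η : Edge → ℤˣ) (s : D.sites → ℤˣ)
    (φ : D.sites → ℝ) :
    D.weight η (signMul s (amplitude φ)) = ENNReal.ofReal (Real.exp (-(2 * (φ ⬝ᵥ φ))) *
      Real.exp (∑ e ∈ D.edges, ((η e : ℤ) : ℝ) * D.coupling (amplitude φ) e *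
        ((bond ends s e : ℤ) : ℝ))) := by
  rw [DiscreteDomain.weight, ← Real.exp_add, D.twistedEnergy_eq]
  congr 2
  have h₁ : signMul s (amplitude φ) ⬝ᵥ signMul s (amplitude φ) = φ ⬝ᵥ φ := by
    refine Finset.sum_congr rfl fun x _ => ?_
    obtain h | h := Int.units_eq_one_or (s x) <;> simp [signMul, amplitude, h]
  rw [h₁, neg_sub, sub_eq_neg_add]
  congr 1
  refine Finset.sum_congr rfl fun e _ => ?_
  have h₂ : ∀ v, 0 ≤ extend D.sites 0 (amplitude φ) v := by
    intro v
    by_cases h : v ∈ D.sites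
    · rw [extend_of_mem h]
      exact abs_nonneg _
    · rw [extend_of_notMem h]
  rw [extend_signMul, extend_signMul, DiscreteDomain.coupling,
    abs_of_nonneg (mul_nonneg (h₂ _) (h₂ _)), bond]
  push_cast
  ring

theorem DiscreteDomain.sum_weight_signMul (D : DiscreteDomain a) (η : Edge → ℤˣ)
    (φ : D.sites → ℝ) :
    ∑ s : D.sites → ℤˣ, D.weight η (signMul s (amplitude φ)) =
      ENNReal.ofReal (Real.exp (-(2 * (φ ⬝ᵥ φ))) *
        D.twistedSum η (D.coupling (amplitude φ))) := by
  simp only [D.weight_signMul]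
  rw [← ENNReal.ofReal_sum_of_nonneg fun s _ => by positivity, ← Finset.mul_sum]
  rfl

/-- Resampling the signs under a twisted Gaussian weight. -/
theorem DiscreteDomain.lintegral_weight_mul (D : DiscreteDomain a) (η : Edge → ℤˣ)
    {g : (D.sites → ℝ) × (D.sites → ℤˣ) → ℝ≥0∞} (hg : Measurable g) :
    2 ^ D.sites.card * ∫⁻ φ, D.weight η φ * g (amplitude φ, fieldSign φ) =
      ∫⁻ φ, ∑ s : D.sites → ℤˣ, D.weight η (signMul s (amplitude φ)) * g (amplitude φ, s) := by
  refine (lintegral_signMul ((D.measurable_weight η).mul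
    (hg.comp (measurable_amplitude.prodMk measurable_fieldSign)))).trans (lintegral_congr_ae ?_)
  filter_upwards [ae_ne_zero] with φ hφ
  refine Finset.sum_congr rfl fun s _ => ?_
  simp only [Pi.mul_apply, Function.comp_apply, amplitude_signMul, fieldSign_signMul s hφ]

theorem DiscreteDomain.measurable_coupling (D : DiscreteDomain a) (e : Edge) :
    Measurable fun r => D.coupling r e :=
  ((measurable_extend _).mul (measurable_extend _)).abs

theorem DiscreteDomain.measurable_twistedSum (D : DiscreteDomain a) (η : Edge → ℤˣ) :
    Measurable fun r => D.twistedSum η (D.coupling r) := by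
  have := D.measurable_coupling
  unfold DiscreteDomain.twistedSum
  fun_prop

/-- Expectations of ratios of partition functions under the Gaussian free field. -/
theorem DiscreteDomain.lintegral_dgff_twistedSum_div (D : DiscreteDomain a) (η : Edge → ℤˣ) :
    ∫⁻ φ, ENNReal.ofReal (D.twistedSum η (D.coupling (amplitude φ)) /
      D.twistedSum 1 (D.coupling (amplitude φ))) ∂D.dgff =
        (∫⁻ φ, D.weight 1 φ)⁻¹ * ∫⁻ φ, D.weight η φ := by
  have hm := ((D.measurable_twistedSum η).div (D.measurable_twistedSum 1)).ennreal_ofReal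
  refine (D.lintegral_dgff (hm.comp measurable_amplitude)).trans ?_
  congr 1
  -- multiply by the number of sign configurations and resample the signs on both sides
  refine (ENNReal.mul_right_inj (a := 2 ^ D.sites.card) (by simp)
    (ENNReal.pow_ne_top (by simp))).1 ?_
  have h₁ := D.lintegral_weight_mul 1 (hm.comp measurable_fst)
  have h₂ := D.lintegral_weight_mul η (g := fun _ => 1) measurable_const
  simp only [mul_one] at h₂
  rw [h₂]
  refine h₁.trans (lintegral_congr fun φ => ?_)
  simp only [Function.comp_apply, Pi.div_apply]
  rw [← Finset.sum_mul, D.sum_weight_signMul, D.sum_weight_signMul,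
    ← ENNReal.ofReal_mul (mul_pos (Real.exp_pos _) (D.twistedSum_pos _ _)).le, mul_assoc,
    mul_div_cancel₀ _ (D.twistedSum_pos _ _).ne']

/-! ### The Ising models given the amplitude of the field -/

theorem isingMeasure_apply (S : Finset (ℤ × ℤ)) (E : Finset Edge)
    (i : Edge → (ℤ × ℤ) × (ℤ × ℤ)) (J : Edge → ℝ) (T : Set (S → ℤˣ)) :
    isingMeasure S E i J T =
      ∑ s, T.indicator (fun s => ENNReal.ofReal (isingProb S E i J s)) s := by
  have hT : MeasurableSet T := MeasurableSet.of_discrete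
  rw [isingMeasure, withDensity_apply _ hT, ← lintegral_indicator hT, lintegral_count, tsum_fintype]
  rfl

instance (S : Finset (ℤ × ℤ)) (E : Finset Edge) (i : Edge → (ℤ × ℤ) × (ℤ × ℤ)) (J : Edge → ℝ) :
    IsProbabilityMeasure (isingMeasure S E i J) where
  measure_univ := by
    simp only [isingMeasure_apply, Set.indicator_univ]
    rw [← ENNReal.ofReal_sum_of_nonneg fun s _ => isingProb_nonneg S E i J s, sum_isingProb,
      ENNReal.ofReal_one]

theorem measurable_isingProb {α : Type*} [MeasurableSpace α] (S : Finset (ℤ × ℤ))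
    (E : Finset Edge) (i : Edge → (ℤ × ℤ) × (ℤ × ℤ)) {J : α → Edge → ℝ}
    (hJ : ∀ e, Measurable fun r => J r e) (s : S → ℤˣ) :
    Measurable fun r => isingProb S E i (J r) s := by
  simp only [isingProb, isingEnergy]
  fun_prop

theorem measurable_isingMeasure {α : Type*} [MeasurableSpace α] (S : Finset (ℤ × ℤ))
    (E : Finset Edge) (i : Edge → (ℤ × ℤ) × (ℤ × ℤ)) {J : α → Edge → ℝ}
    (hJ : ∀ e, Measurable fun r => J r e) : Measurable fun r => isingMeasure S E i (J r) := by
  refine Measure.measurable_of_measurable_coe _ fun T _ => ?_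
  simp only [isingMeasure_apply]
  refine Finset.measurable_sum _ fun s _ => ?_
  by_cases hs : s ∈ T
  · simp only [Set.indicator_of_mem hs]
    exact (measurable_isingProb S E i hJ s).ennreal_ofReal
  · simp only [Set.indicator_of_notMem hs]
    exact measurable_const

theorem DiscreteDomain.measurable_dualCoupling (D : DiscreteDomain a) (e : Edge) :
    Measurable fun r => dualCoupling (D.coupling r) e := by
  have h := D.measurable_coupling e
  have ht : Measurable Real.tanh := by
    rw [funext Real.tanh_eq_sinh_div_cosh]
    exact Real.measurable_sinh.div Real.measurable_cosh
  exact ((ht.comp h).log).const_mul _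

theorem DiscreteDomain.coupling_pos (D : DiscreteDomain a) {φ : D.sites → ℝ}
    (hφ : ∀ x, φ x ≠ 0) {e : Edge} (he : e ∈ D.edges) : 0 < D.coupling (amplitude φ) e := by
  obtain ⟨h₁, h₂⟩ := D.ends_mem_sites he
  rw [DiscreteDomain.coupling, extend_of_mem h₁, extend_of_mem h₂]
  exact abs_pos.2 (mul_ne_zero (abs_ne_zero.2 (hφ _)) (abs_ne_zero.2 (hφ _)))

theorem DiscreteDomain.lintegral_map_dgff (D : DiscreteDomain a) {β : Type*} [MeasurableSpace β]
    {T : (D.sites → ℝ) → β} (hT : Measurable T) {f : β → ℝ≥0∞} (hf : Measurable f) :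
    ∫⁻ y, f y ∂(D.dgff.map T) = (∫⁻ φ, D.weight 1 φ)⁻¹ * ∫⁻ φ, D.weight 1 φ * f (T φ) := by
  rw [lintegral_map hf hT]
  exact D.lintegral_dgff (hf.comp hT)

/-- The correlations of the dual Ising model with random couplings are ratios of Gaussian
partition functions. -/
theorem DiscreteDomain.sum_prod_spins_dual (ha : 0 < a) (D : DiscreteDomain a)
    (B : Finset D.faces) :
    ∑ t : D.faces → ℤˣ, (((∏ z ∈ B, t z : ℤˣ) : ℤ) : ℝ) *
        ((D.dgff.map amplitude).bind fun r => D.isingDualPlus (dualCoupling (D.coupling r))).real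
          {t} =
      √(1 - D.stepMatrix 1).det /
        √(1 - D.stepMatrix (gauge (B.map (Function.Embedding.subtype _)))).det := by
  set η := gauge (B.map (Function.Embedding.subtype _)) with hη
  let p : (D.sites → ℝ) → (D.faces → ℤˣ) → ℝ := fun φ =>
    isingProb D.faces D.edges dualEnds (dualCoupling (D.coupling (amplitude φ)))
  have hker : Measurable fun r => D.isingDualPlus (dualCoupling (D.coupling r)) :=
    measurable_isingMeasure D.faces D.edges dualEnds D.measurable_dualCoupling
  have hp : ∀ t, Measurable fun φ => p φ t := fun t =>
    (measurable_isingProb D.faces D.edges dualEnds D.measurable_dualCoupling t).comp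
      measurable_amplitude
  have hp0 : ∀ φ t, 0 ≤ p φ t := fun φ t => isingProb_nonneg _ _ _ _ _
  have hp1 : ∀ φ t, p φ t ≤ 1 := fun φ t =>
    (Finset.single_le_sum (fun t _ => hp0 φ t) (Finset.mem_univ t)).trans
      (sum_isingProb _ _ _ _).le
  have hint : ∀ t, Integrable (fun φ => p φ t) D.dgff := fun t =>
    Integrable.of_bound (hp t).aestronglyMeasurable 1
      (ae_of_all _ fun φ => by rw [Real.norm_of_nonneg (hp0 φ t)]; exact hp1 φ t)
  have h₁ : ∀ t, ((D.dgff.map amplitude).bind fun r =>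
      D.isingDualPlus (dualCoupling (D.coupling r))).real {t} = ∫ φ, p φ t ∂D.dgff := by
    intro t
    rw [Measure.real_def, Measure.bind_apply MeasurableSet.of_discrete hker.aemeasurable,
      lintegral_map
        (show Measurable fun r => D.isingDualPlus (dualCoupling (D.coupling r)) {t} from
          (Measure.measurable_coe MeasurableSet.of_discrete).comp hker) measurable_amplitude,
      integral_eq_lintegral_of_nonneg_ae (ae_of_all _ fun φ => hp0 φ t)
        (hp t).aestronglyMeasurable]
    congr 1
    refine lintegral_congr fun φ => ?_
    rw [DiscreteDomain.isingDualPlus, isingMeasure_apply, Finset.sum_eq_single t]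
    · rw [Set.indicator_of_mem (Set.mem_singleton t)]
    · intro t' _ ht'
      exact Set.indicator_of_notMem (by simpa using ht') _
    · simp
  have h₂ : ∫ φ, ∑ t : D.faces → ℤˣ, (((∏ z ∈ B, t z : ℤˣ) : ℤ) : ℝ) * p φ t ∂D.dgff =
      ∫ φ, D.twistedSum η (D.coupling (amplitude φ)) /
        D.twistedSum 1 (D.coupling (amplitude φ)) ∂D.dgff := by
    refine integral_congr_ae ?_
    -- a vanishing field value would produce the junk value `log 0` in the dual couplings
    filter_upwards [D.dgff_absolutelyContinuous.ae_le ae_ne_zero] with φ hφ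
    exact D.sum_isingProb_dual ha (fun e he => D.coupling_pos hφ he) B
  simp only [h₁, ← integral_const_mul]
  rw [← integral_finsetSum _ fun t _ => (hint t).const_mul _, h₂,
    integral_eq_lintegral_of_nonneg_ae
      (ae_of_all _ fun φ => div_nonneg (D.twistedSum_pos _ _).le (D.twistedSum_pos _ _).le)
      (((D.measurable_twistedSum η).div (D.measurable_twistedSum 1)).comp
        measurable_amplitude).aestronglyMeasurable,
    D.lintegral_dgff_twistedSum_div]
  obtain ⟨c, hc0, hc, h⟩ := D.lintegral_weight
  rw [h, h, ENNReal.toReal_mul, ENNReal.toReal_inv, ENNReal.toReal_mul, ENNReal.toReal_mul,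
    ENNReal.toReal_ofReal (by positivity), ENNReal.toReal_ofReal (by positivity)]
  have hc' : c.toReal ≠ 0 := ENNReal.toReal_ne_zero.2 ⟨hc0, hc⟩
  rw [mul_inv, inv_inv]
  field_simp

/-- Given its amplitude, the sign of the Gaussian free field is a free Ising model. -/
theorem DiscreteDomain.map_amplitude_fieldSign (D : DiscreteDomain a) :
    (D.dgff.map fun φ => (amplitude φ, fieldSign φ)) =
      (D.dgff.map amplitude).bind fun r => (D.isingFree (D.coupling r)).map fun s => (r, s) := by
  have hpair : ∀ r : D.sites → ℝ, Measurable fun s : D.sites → ℤˣ => (r, s) := fun r =>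
    measurable_const.prodMk measurable_id
  have happly : ∀ (A : Set ((D.sites → ℝ) × (D.sites → ℤˣ))), MeasurableSet A → ∀ r,
      ((D.isingFree (D.coupling r)).map fun s => (r, s)) A =
        ∑ s, ENNReal.ofReal (isingProb D.sites D.edges ends (D.coupling r) s) *
          A.indicator 1 (r, s) := by
    intro A hA r
    rw [Measure.map_apply (hpair r) hA, DiscreteDomain.isingFree, isingMeasure_apply]
    refine Finset.sum_congr rfl fun s _ => ?_
    by_cases h : (r, s) ∈ A
    · rw [Set.indicator_of_mem h, Set.indicator_of_mem (Set.mem_preimage.2 h)]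
      simp
    · rw [Set.indicator_of_notMem h, Set.indicator_of_notMem (mt Set.mem_preimage.1 h)]
      simp
  have hsum : ∀ (A : Set ((D.sites → ℝ) × (D.sites → ℤˣ))), MeasurableSet A →
      Measurable fun r => ∑ s, ENNReal.ofReal (isingProb D.sites D.edges ends (D.coupling r) s) *
          A.indicator 1 (r, s) := fun A hA => Finset.measurable_sum _ fun s _ =>
    (measurable_isingProb D.sites D.edges ends D.measurable_coupling s).ennreal_ofReal.mul
      ((measurable_one.indicator hA).comp (measurable_id.prodMk measurable_const))
  have hker' : Measurable fun r => (D.isingFree (D.coupling r)).map fun s => (r, s) := by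
    refine Measure.measurable_of_measurable_coe _ fun A hA => ?_
    simp only [happly A hA]
    exact hsum A hA
  refine Measure.ext fun A hA => ?_
  have hmeas : Measurable fun φ : D.sites → ℝ => (amplitude φ, fieldSign φ) :=
    measurable_amplitude.prodMk measurable_fieldSign
  have hind : Measurable (A.indicator (1 : (D.sites → ℝ) × (D.sites → ℤˣ) → ℝ≥0∞)) :=
    measurable_one.indicator hA
  rw [Measure.bind_apply hA hker'.aemeasurable]
  simp only [happly A hA]
  rw [← lintegral_indicator_one hA, D.lintegral_map_dgff measurable_amplitude (hsum A hA),
    D.lintegral_map_dgff hmeas hind]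
  congr 1
  -- multiply by the number of sign configurations and resample the signs on both sides
  refine (ENNReal.mul_right_inj (a := 2 ^ D.sites.card) (by simp)
    (ENNReal.pow_ne_top (by simp))).1 ?_
  refine (D.lintegral_weight_mul 1 hind).trans
    (Eq.trans ?_ (D.lintegral_weight_mul 1 ((hsum A hA).comp measurable_fst)).symm)
  refine lintegral_congr fun φ => ?_
  simp only [Function.comp_apply]
  rw [← Finset.sum_mul, Finset.mul_sum]
  refine Finset.sum_congr rfl fun s _ => ?_
  have hpos := D.twistedSum_pos 1 (D.coupling (amplitude φ))
  rw [← mul_assoc, D.sum_weight_signMul, D.weight_signMul, D.isingProb_free,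
    ← ENNReal.ofReal_mul (mul_pos (Real.exp_pos _) hpos).le, mul_assoc (Real.exp _),
    mul_div_cancel₀ _ hpos.ne']
  simp

end LoopSoup

end

open LoopSoup in
theorem mainTheorem3 (a : ℝ) (ha : 0 < a) (D : DiscreteDomain a) :
    -- the soup with intensity `1/2` is almost surely finite, so that its spin field makes sense
    (∀ᵐ L ∂(loopSoup D (1 / 2)), {γ : Loop D | L γ ≠ 0}.Finite) ∧
    -- sampling `|φ|` and then the dual Ising model with `+1` boundary conditions gives the law of
    -- the spin field
    ((D.dgff.map amplitude).bind fun r => D.isingDualPlus (dualCoupling (D.coupling r))) =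
      (loopSoup D (1 / 2)).map (spinField D) ∧
    -- the dual model: given `|φ|`, the law of `sgn φ` is the free Ising model
    (D.dgff.map fun φ => (amplitude φ, fieldSign φ)) =
      (D.dgff.map amplitude).bind fun r => (D.isingFree (D.coupling r)).map fun s => (r, s) := by
  refine ⟨ae_finite_loopSoup D _, ?_, D.map_amplitude_fieldSign⟩
  have : IsProbabilityMeasure ((loopSoup D (1 / 2)).map (spinField D)) :=
    Measure.isProbabilityMeasure_map (aemeasurable_spinField D _)
  have : IsProbabilityMeasure (D.dgff.map amplitude) :=
    Measure.isProbabilityMeasure_map measurable_amplitude.aemeasurable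
  have : IsProbabilityMeasure ((D.dgff.map amplitude).bind fun r =>
      D.isingDualPlus (dualCoupling (D.coupling r))) :=
    isProbabilityMeasure_bind (measurable_isingMeasure D.faces D.edges dualEnds
      D.measurable_dualCoupling).aemeasurable (ae_of_all _ fun r => by
        unfold DiscreteDomain.isingDualPlus
        infer_instance)
  refine ext_of_sum_prod_spins fun B => ?_
  rw [D.sum_prod_spins_dual ha B, sum_prod_spins_loopSoup ha D B]
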